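/- Let $a$ and $b$ be the multiplicative functions on the positive integers with $a(n)=b(n)=\sigma_1(n)$ for odd $n$, $a(2^m)=2^m$ and $b(2^m)=0$ for $m\ge 1$. For real $v$ and $x>0$ put $$g(v,x)=e^{v/2}\exp\!\Big(-\frac{x}{2}\,(e^{v}+e^{-v})\Big),$$ and for complex $s$ let $$K_s(x)=\frac12\int_0^\infty u^{s-1}\exp\!\Big(-\frac x2\Big(u+\frac1u\Big)\Big)\,du$$ be the modified Bessel function of the second kind. Define $$G(v)=\sum_{j=1}^{\infty}\sum_{d\mid j}a(d)\,b\Big(\frac jd\Big)\Big(\frac{j}{d^2}\Big)^{1/4} g\Big(v-\tfrac12\log\frac{j}{d^2},\,2\pi\sqrt j\Big)\qquad(v\in\mathbb R).$$ Then the series converges absolutely for every real $v$, the function $v\mapsto e^{itv}G(v)$ is integrable on $\mathbb R$ for every $t\in\mathbb C$, and the Fourier transform $\hat G(t)=\int_{-\infty}^{\infty}e^{itv}G(v)\,dv$ satisfies $$\hat G(t)=\sum_{j=1}^{\infty}\sum_{d\mid j}a(d)\,b\Big(\frac jd\Big)\Big(\frac{j}{d^2}\Big)^{\frac12\left(\frac12+it\right)}2K_{\frac12+it}(2\pi\sqrt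 j)\qquad(t\in\mathbb C),$$ where the series over $j$ converges absolutely. Moreover $\hat G(\gamma)=0$ for every $\gamma\in\mathbb C$ such that $\rho=\frac12+i\gamma$ is a nonreal zero of the Riemann zeta function ($\gamma$ is not assumed to be real). Consequently, with $\gamma$ running over all such numbers, counted with or without the multiplicity of $\rho$, $$\sum_\gamma\hat G(\gamma)=\sum_\gamma\sum_{j=1}^{\infty}\sum_{d\mid j}a(d)\,b\Big(\frac jd\Big)\Big(\frac{j}{d^2}\Big)^{\frac14+\frac{i\gamma}{2}}2K_{\frac12+i\gamma}(2\pi\sqrt j)=0.$$ -/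

import Mathlib

noncomputable section

namespace PrimePower

/-- The multiplicative function with `a n = σ₁ n` for odd `n` and `a (2 ^ m) = 2 ^ m`:
`a (2 ^ m * k) = 2 ^ m * σ₁ k` for odd `k` (see `a_odd`, `a_two_pow`, `a_mul`). -/
def a (n : ℕ) : ℕ :=
  2 ^ n.factorization 2 * ArithmeticFunction.sigma 1 (n / 2 ^ n.factorization 2)

/-- The multiplicative function with `b n = σ₁ n` for odd `n` and `b (2 ^ m) = 0` for `m ≥ 1`
(see `b_odd`, `b_two_pow`, `b_mul`). -/
def b (n : ℕ) : ℕ :=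
  if Odd n then ArithmeticFunction.sigma 1 n else 0

theorem a_odd {n : ℕ} (hn : Odd n) : a n = ArithmeticFunction.sigma 1 n := by
  have h : n.factorization 2 = 0 :=
    Nat.factorization_eq_zero_of_not_dvd hn.not_two_dvd_nat
  simp [a, h]

theorem a_two_pow (m : ℕ) : a (2 ^ m) = 2 ^ m := by
  have h : (2 ^ m).factorization 2 = m := by
    rw [Nat.prime_two.factorization_pow, Finsupp.single_eq_same]
  unfold a
  rw [h, Nat.div_self (by positivity)]
  simp

theorem a_mul {m n : ℕ} (h : m.Coprime n) : a (m * n) = a m * a n := by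
  have hc : (m / 2 ^ m.factorization 2).Coprime (n / 2 ^ n.factorization 2) :=
    Nat.Coprime.of_dvd (Nat.ordCompl_dvd m 2) (Nat.ordCompl_dvd n 2) h
  have hs := ArithmeticFunction.isMultiplicative_sigma (k := 1) |>.map_mul_of_coprime hc
  unfold a
  rw [Nat.ordCompl_mul, Nat.factorization_mul_of_coprime h, hs, Finsupp.add_apply, pow_add]
  ring

theorem b_odd {n : ℕ} (hn : Odd n) : b n = ArithmeticFunction.sigma 1 n := if_pos hn

theorem b_two_pow {m : ℕ} (hm : 1 ≤ m) : b (2 ^ m) = 0 := by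
  have h : ¬ Odd (2 ^ m) := by
    rw [Nat.not_odd_iff_even]
    exact (Nat.even_pow.2 ⟨even_two, by omega⟩)
  exact if_neg h

theorem b_mul {m n : ℕ} (h : m.Coprime n) : b (m * n) = b m * b n := by
  have hs := ArithmeticFunction.isMultiplicative_sigma (k := 1) |>.map_mul_of_coprime h
  unfold b
  by_cases hm : Odd m <;> by_cases hn : Odd n <;> simp [Nat.odd_mul, hm, hn, hs]

/-- The modified Bessel function of the second kind `K_s(x)`, for complex order `s` and `x > 0`:
`K_s(x) = (1/2) ∫₀^∞ u^(s-1) exp(-(x/2)(u + 1/u)) du`. -/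
def besselK (s : ℂ) (x : ℝ) : ℂ :=
  (1 / 2) * ∫ u in Set.Ioi (0 : ℝ),
    (u : ℂ) ^ (s - 1) * ((Real.exp (-(x / 2) * (u + 1 / u)) : ℝ) : ℂ)

/-- `g(v, x) = e^(v/2) exp(-(x/2)(e^v + e^(-v)))`. -/
def g (v x : ℝ) : ℝ :=
  Real.exp (v / 2) * Real.exp (-(x / 2) * (Real.exp v + Real.exp (-v)))

/-- The translation `T = (1/2) log (j / d²)`. -/
def shift (d j : ℕ) : ℝ := (1 / 2) * Real.log ((j : ℝ) / (d : ℝ) ^ 2)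

/-- The `j`-th term `∑_{d ∣ j} a(d) b(j/d) (j/d²)^(1/4) g(v - T, 2π√j)` of the series for `G`. -/
def termG (v : ℝ) (j : ℕ+) : ℝ :=
  ∑ d ∈ (j : ℕ).divisors,
    (a d : ℝ) * (b ((j : ℕ) / d) : ℝ) * (((j : ℕ) : ℝ) / (d : ℝ) ^ 2) ^ (1 / 4 : ℝ) *
      g (v - shift d j) (2 * Real.pi * √((j : ℕ) : ℝ))

/-- The function `G(v) = ∑_{j ≥ 1} ∑_{d ∣ j} a(d) b(j/d) (j/d²)^(1/4) g(v - T, 2π√j)`. -/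
def G (v : ℝ) : ℝ := ∑' j : ℕ+, termG v j

/-- The Fourier transform `∫ e^(itv) f(v) dv` at a complex argument `t`. -/
def fourierTransform (f : ℝ → ℝ) (t : ℂ) : ℂ :=
  ∫ v : ℝ, Complex.exp (Complex.I * t * (v : ℂ)) * (f v : ℂ)

/-- The `j`-th term `∑_{d ∣ j} a(d) b(j/d) (j/d²)^((1/2+it)/2) 2 K_{1/2+it}(2π√j)`. -/
def termGHat (t : ℂ) (j : ℕ+) : ℂ :=
  ∑ d ∈ (j : ℕ).divisors,
    (a d : ℂ) * (b ((j : ℕ) / d) : ℂ) *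
      (((j : ℕ) : ℂ) / (d : ℂ) ^ 2) ^ ((1 / 2 + Complex.I * t) / 2) *
      (2 * besselK (1 / 2 + Complex.I * t) (2 * Real.pi * √((j : ℕ) : ℝ)))

/-- The complex numbers `γ` such that `ρ = 1/2 + iγ` is a nonreal zero of the Riemann zeta
function. -/
def zetaOrdinates : Set ℂ :=
  {γ | riemannZeta (1 / 2 + Complex.I * γ) = 0 ∧ (1 / 2 + Complex.I * γ).im ≠ 0}

/-- The multiplicity of `ρ = 1/2 + iγ` as a zero of the Riemann zeta function. -/
def zetaMultiplicity (γ : ℂ) : ℕ :=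
  analyticOrderNatAt riemannZeta (1 / 2 + Complex.I * γ)

end PrimePower

end

/-! Put A(y) = ∑ a(n) e^(-πny), B(y) = ∑ b(n) e^(-πny), S(y) = ∑ σ₁(n) e^(-πny). Writing j = dm and
undoing the shift T turns each summand of G into e^(v/2) a(d) b(m) exp(-π(d e^v + m e^(-v))), so
G(v) = e^(v/2) A(e^v) B(e^(-v)) (`G_eq`). With y = e^v, Ĝ(t) is therefore M(1/2 + it), where M is
the Mellin transform of A(y) B(1/y). This product decays exponentially at both ends, so M is entire;
integrating term by term gives the Bessel series (`hasSum_termGHat`).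

The vanishing rests on a coincidence that makes the product linear in B. Since A(y) = S(y) - S(2y),
the transformation law of the weight 2 Eisenstein series gives A(1/x) = (x²/8) L(x) - x/(4π) with
L(x) = 1 + 8 S(2x) - 32 S(4x). The same L is the logarithmic derivative of B: ∑ n b(n) e^(-πnx) =
L(x) B(x) (`seriesNB_eq`). Hence A(1/x) B(x) is a combination of x² ∑ n b(n) e^(-πnx) and x B(x)
(`seriesA_inv_mul_seriesB`). The Dirichlet series of b is ζ(w) ζ(w-1) times an Euler factor at 2, so
M(s)/Γ(1-s) is an elementary factor times ζ(1-s) ζ(-s), first for Re s < -3 and then by continuation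
(`mellin_productSeries_div_Gamma`). A nonreal zero s of ζ gives ζ(1-s) = 0 by the functional
equation, so M(s) = 0. Every term of the sum over γ is then zero.

The identity for L is proved by elementary means: on coefficients it is a convolution formula, which
follows from a Liouville-type identity on the representations n = ax + by
(`sum_repsEven_dist_sub_add`). -/

noncomputable section

namespace PrimePower

open Finset

/-! ### A Liouville-type identity for representations n = ax + by -/

/-- The representations `n = c * x + b * y` with positive `c`, `x`, `b`, `y`, as tuples
`(c, x, b, y)`. -/
def reps (n : ℕ) : Finset (ℕ × ℕ × ℕ × ℕ) :=
  (Icc 1 n ×ˢ Icc 1 n ×ˢ Icc 1 n ×ˢ Icc 1 n).filter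
    fun t => t.1 * t.2.1 + t.2.2.1 * t.2.2.2 = n

theorem mem_reps {n c x b y : ℕ} :
    (c, x, b, y) ∈ reps n ↔ 0 < c ∧ 0 < x ∧ 0 < b ∧ 0 < y ∧ c * x + b * y = n := by
  simp only [reps, mem_filter, mem_product, mem_Icc]
  constructor
  · rintro ⟨⟨h1, h2, h3, h4⟩, h⟩
    omega
  · rintro ⟨h1, h2, h3, h4, h⟩
    have e1 : c ≤ c * x := Nat.le_mul_of_pos_right c h2
    have e2 : x ≤ c * x := Nat.le_mul_of_pos_left x h1
    have e3 : b ≤ b * y := Nat.le_mul_of_pos_right b h4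
    have e4 : y ≤ b * y := Nat.le_mul_of_pos_left y h3
    omega

/-- Moves a Cauchy product of divisor sums to quadruples, where the bijections below act. -/
theorem sum_antidiagonal_mul_sum_divisorsAntidiagonal (u w : ℕ × ℕ → ℤ) (n : ℕ) :
    ∑ p ∈ antidiagonal n, (∑ q ∈ p.1.divisorsAntidiagonal, u q) *
        ∑ r ∈ p.2.divisorsAntidiagonal, w r =
      ∑ t ∈ reps n, u (t.1, t.2.1) * w (t.2.2.1, t.2.2.2) := by
  simp_rw [sum_mul_sum, ← sum_product']
  rw [sum_sigma']
  refine sum_bij' (fun z _ => (z.2.1.1, z.2.1.2, z.2.2.1, z.2.2.2))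
    (fun t _ => ⟨(t.1 * t.2.1, t.2.2.1 * t.2.2.2), (t.1, t.2.1), (t.2.2.1, t.2.2.2)⟩) ?_ ?_ ?_ ?_ ?_
  · rintro ⟨⟨k, l⟩, ⟨c, x⟩, ⟨b, y⟩⟩ h
    simp only [mem_sigma, HasAntidiagonal.mem_antidiagonal, mem_product,
      Nat.mem_divisorsAntidiagonal] at h
    obtain ⟨h, ⟨rfl, h1⟩, ⟨rfl, h2⟩⟩ := h
    rw [mul_ne_zero_iff] at h1 h2
    exact mem_reps.2 ⟨Nat.pos_of_ne_zero h1.1, Nat.pos_of_ne_zero h1.2, Nat.pos_of_ne_zero h2.1,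
      Nat.pos_of_ne_zero h2.2, h⟩
  · rintro ⟨c, x, b, y⟩ h
    rw [mem_reps] at h
    obtain ⟨h1, h2, h3, h4, h⟩ := h
    simp only [mem_sigma, HasAntidiagonal.mem_antidiagonal, mem_product,
      Nat.mem_divisorsAntidiagonal, true_and]
    exact ⟨h, by positivity, by positivity⟩
  · rintro ⟨⟨k, l⟩, ⟨c, x⟩, ⟨b, y⟩⟩ h
    simp only [mem_sigma, HasAntidiagonal.mem_antidiagonal, mem_product,
      Nat.mem_divisorsAntidiagonal] at h
    obtain ⟨h, ⟨rfl, h1⟩, ⟨rfl, h2⟩⟩ := h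
    rfl
  · rintro ⟨c, x, b, y⟩ h
    rfl
  · rintro ⟨⟨k, l⟩, ⟨c, x⟩, ⟨b, y⟩⟩ h
    rfl

/-- The representations `n = c * x + b * y` with `x` and `y` odd. -/
def repsOdd (n : ℕ) : Finset (ℕ × ℕ × ℕ × ℕ) :=
  (reps n).filter fun t => Odd t.2.1 ∧ Odd t.2.2.2

/-- The representations `n = c * x + b * y` with `x` even and `y` odd. -/
def repsEvenOdd (n : ℕ) : Finset (ℕ × ℕ × ℕ × ℕ) :=
  (reps n).filter fun t => Even t.2.1 ∧ Odd t.2.2.2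

/-- The representations `n = c * x + b * y` with `y` even. -/
def repsEven (n : ℕ) : Finset (ℕ × ℕ × ℕ × ℕ) :=
  (reps n).filter fun t => Even t.2.2.2

theorem sum_filter_trichotomy {ι : Type*} (s : Finset ι) (u v : ι → ℕ) (f : ι → ℤ) :
    ∑ t ∈ s, f t = ∑ t ∈ s with u t < v t, f t + ∑ t ∈ s with v t < u t, f t +
      ∑ t ∈ s with u t = v t, f t := by
  simp_rw [sum_filter, ← sum_add_distrib]
  refine sum_congr rfl fun t _ => ?_
  rcases lt_trichotomy (u t) (v t) with h | h | h
  · simp [h, h.ne, h.not_gt]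
  · simp [h]
  · simp [h, h.ne', h.not_gt]

variable {n : ℕ} (f : ℕ → ℤ)

theorem odd_of_mem_repsEven (hn : Odd n) {a x b y : ℕ} (h : (a, x, b, y) ∈ repsEven n) :
    Odd a ∧ Odd x := by
  obtain ⟨h1, h2⟩ := mem_filter.1 h
  rw [mem_reps] at h1
  rw [← Nat.odd_mul]
  have := h1.2.2.2.2
  subst this
  exact (Nat.odd_add.1 hn).2 (h2.mul_left b)

/-- Rewrite ax + by = (a - b)x + b(x + y). As n is odd and y even, x is odd, so x + y is odd too.
The next lemmas use the same kind of regrouping. -/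
theorem sum_repsEven_sub_of_lt (hn : Odd n) :
    ∑ t ∈ repsEven n with t.2.2.1 < t.1, f (t.1 - t.2.2.1) =
      ∑ t ∈ repsOdd n with t.2.1 < t.2.2.2, f t.1 := by
  refine sum_bij' (fun t _ => (t.1 - t.2.2.1, t.2.1, t.2.2.1, t.2.1 + t.2.2.2))
    (fun t _ => (t.1 + t.2.2.1, t.2.1, t.2.2.1, t.2.2.2 - t.2.1)) ?_ ?_ ?_ ?_ ?_
  · rintro ⟨a, x, b, y⟩ h
    have ho := odd_of_mem_repsEven hn (mem_filter.1 h).1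
    simp only [repsOdd, repsEven, mem_filter, mem_reps] at h ⊢
    obtain ⟨⟨⟨h1, h2, h3, h4, h5⟩, h6⟩, h7⟩ := h
    obtain ⟨c, rfl⟩ := Nat.exists_eq_add_of_lt h7
    refine ⟨⟨⟨by omega, h2, h3, by omega, ?_⟩, ho.2, ho.2.add_even h6⟩, by omega⟩
    rw [← h5, show b + c + 1 - b = c + 1 by omega]
    ring
  · rintro ⟨a, x, b, y⟩ h
    simp only [repsOdd, repsEven, mem_filter, mem_reps] at h ⊢
    obtain ⟨⟨⟨h1, h2, h3, h4, h5⟩, h6⟩, h7⟩ := h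
    refine ⟨⟨⟨by omega, h2, h3, by omega, ?_⟩, Nat.Odd.sub_odd h6.2 h6.1⟩, by omega⟩
    obtain ⟨c, rfl⟩ := Nat.exists_eq_add_of_lt h7
    rw [← h5, show x + c + 1 - x = c + 1 by omega]
    ring
  · rintro ⟨a, x, b, y⟩ h
    simp only [mem_filter] at h
    simp only [Prod.mk.injEq, true_and]
    omega
  · rintro ⟨a, x, b, y⟩ h
    simp only [mem_filter] at h
    simp only [Prod.mk.injEq, true_and]
    omega
  · rintro ⟨a, x, b, y⟩ h
    rfl

/-- Here ax + by = (b - a)y + a(x + y); the even part y now comes first. -/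
theorem sum_repsEven_sub_of_gt (hn : Odd n) :
    ∑ t ∈ repsEven n with t.1 < t.2.2.1, f (t.2.2.1 - t.1) =
      ∑ t ∈ repsEvenOdd n with t.2.1 < t.2.2.2, f t.1 := by
  refine sum_bij' (fun t _ => (t.2.2.1 - t.1, t.2.2.2, t.1, t.2.1 + t.2.2.2))
    (fun t _ => (t.2.2.1, t.2.2.2 - t.2.1, t.1 + t.2.2.1, t.2.1)) ?_ ?_ ?_ ?_ ?_
  · rintro ⟨a, x, b, y⟩ h
    have ho := odd_of_mem_repsEven hn (mem_filter.1 h).1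
    simp only [repsEvenOdd, repsEven, mem_filter, mem_reps] at h ⊢
    obtain ⟨⟨⟨h1, h2, h3, h4, h5⟩, h6⟩, h7⟩ := h
    obtain ⟨c, rfl⟩ := Nat.exists_eq_add_of_lt h7
    refine ⟨⟨⟨by omega, h4, h1, by omega, ?_⟩, h6, ho.2.add_even h6⟩, by omega⟩
    rw [← h5, show a + c + 1 - a = c + 1 by omega]
    ring
  · rintro ⟨a, x, b, y⟩ h
    simp only [repsEvenOdd, repsEven, mem_filter, mem_reps] at h ⊢
    obtain ⟨⟨⟨h1, h2, h3, h4, h5⟩, h6⟩, h7⟩ := h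
    refine ⟨⟨⟨h3, by omega, by omega, h2, ?_⟩, h6.1⟩, by omega⟩
    obtain ⟨c, rfl⟩ := Nat.exists_eq_add_of_lt h7
    rw [← h5, show x + c + 1 - x = c + 1 by omega]
    ring
  · rintro ⟨a, x, b, y⟩ h
    simp only [mem_filter] at h
    simp only [Prod.mk.injEq, true_and, and_true]
    omega
  · rintro ⟨a, x, b, y⟩ h
    simp only [mem_filter] at h
    simp only [Prod.mk.injEq, true_and]
    omega
  · rintro ⟨a, x, b, y⟩ h
    rfl

/-- Here ax + by = (a + b)x + b(y - x). -/
theorem sum_repsEven_add_of_lt (hn : Odd n) :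
    ∑ t ∈ repsEven n with t.2.1 < t.2.2.2, f (t.1 + t.2.2.1) =
      ∑ t ∈ repsOdd n with t.2.2.1 < t.1, f t.1 := by
  refine sum_bij' (fun t _ => (t.1 + t.2.2.1, t.2.1, t.2.2.1, t.2.2.2 - t.2.1))
    (fun t _ => (t.1 - t.2.2.1, t.2.1, t.2.2.1, t.2.1 + t.2.2.2)) ?_ ?_ ?_ ?_ ?_
  · rintro ⟨a, x, b, y⟩ h
    have ho := odd_of_mem_repsEven hn (mem_filter.1 h).1
    simp only [repsOdd, repsEven, mem_filter, mem_reps] at h ⊢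
    obtain ⟨⟨⟨h1, h2, h3, h4, h5⟩, h6⟩, h7⟩ := h
    refine ⟨⟨⟨by omega, h2, h3, by omega, ?_⟩, ho.2, Nat.Even.sub_odd h7.le h6 ho.2⟩, by omega⟩
    obtain ⟨c, rfl⟩ := Nat.exists_eq_add_of_lt h7
    rw [← h5, show x + c + 1 - x = c + 1 by omega]
    ring
  · rintro ⟨a, x, b, y⟩ h
    simp only [repsOdd, repsEven, mem_filter, mem_reps] at h ⊢
    obtain ⟨⟨⟨h1, h2, h3, h4, h5⟩, h6⟩, h7⟩ := h
    refine ⟨⟨⟨by omega, h2, h3, by omega, ?_⟩, h6.1.add_odd h6.2⟩, by omega⟩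
    obtain ⟨c, rfl⟩ := Nat.exists_eq_add_of_lt h7
    rw [← h5, show b + c + 1 - b = c + 1 by omega]
    ring
  · rintro ⟨a, x, b, y⟩ h
    simp only [mem_filter] at h
    simp only [Prod.mk.injEq, true_and]
    omega
  · rintro ⟨a, x, b, y⟩ h
    simp only [mem_filter] at h
    simp only [Prod.mk.injEq, true_and]
    omega
  · rintro ⟨a, x, b, y⟩ h
    rfl

/-- Here ax + by = (a + b)y + a(x - y). -/
theorem sum_repsEven_add_of_gt (hn : Odd n) :
    ∑ t ∈ repsEven n with t.2.2.2 < t.2.1, f (t.1 + t.2.2.1) =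
      ∑ t ∈ repsEvenOdd n with t.2.2.1 < t.1, f t.1 := by
  refine sum_bij' (fun t _ => (t.1 + t.2.2.1, t.2.2.2, t.1, t.2.1 - t.2.2.2))
    (fun t _ => (t.2.2.1, t.2.1 + t.2.2.2, t.1 - t.2.2.1, t.2.1)) ?_ ?_ ?_ ?_ ?_
  · rintro ⟨a, x, b, y⟩ h
    have ho := odd_of_mem_repsEven hn (mem_filter.1 h).1
    simp only [repsEvenOdd, repsEven, mem_filter, mem_reps] at h ⊢
    obtain ⟨⟨⟨h1, h2, h3, h4, h5⟩, h6⟩, h7⟩ := h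
    refine ⟨⟨⟨by omega, h4, h1, by omega, ?_⟩, h6, Nat.Odd.sub_even h7.le ho.2 h6⟩, by omega⟩
    obtain ⟨c, rfl⟩ := Nat.exists_eq_add_of_lt h7
    rw [← h5, show y + c + 1 - y = c + 1 by omega]
    ring
  · rintro ⟨a, x, b, y⟩ h
    simp only [repsEvenOdd, repsEven, mem_filter, mem_reps] at h ⊢
    obtain ⟨⟨⟨h1, h2, h3, h4, h5⟩, h6⟩, h7⟩ := h
    refine ⟨⟨⟨h3, by omega, by omega, h2, ?_⟩, h6.1⟩, by omega⟩
    obtain ⟨c, rfl⟩ := Nat.exists_eq_add_of_lt h7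
    rw [← h5, show b + c + 1 - b = c + 1 by omega]
    ring
  · rintro ⟨a, x, b, y⟩ h
    simp only [mem_filter] at h
    simp only [Prod.mk.injEq, true_and, and_true]
    omega
  · rintro ⟨a, x, b, y⟩ h
    simp only [mem_filter] at h
    simp only [Prod.mk.injEq, true_and]
    omega
  · rintro ⟨a, x, b, y⟩ h
    rfl

/-- Here ax + by = a(x - y) + (a + b)y, which keeps a and flips the parity of the second entry;
`sum_repsEvenOdd_of_gt` is the same map from the other parity class. -/
theorem sum_repsOdd_of_gt :
    ∑ t ∈ repsOdd n with t.2.2.2 < t.2.1, f t.1 =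
      ∑ t ∈ repsEvenOdd n with t.1 < t.2.2.1, f t.1 := by
  refine sum_bij' (fun t _ => (t.1, t.2.1 - t.2.2.2, t.2.2.1 + t.1, t.2.2.2))
    (fun t _ => (t.1, t.2.1 + t.2.2.2, t.2.2.1 - t.1, t.2.2.2)) ?_ ?_ ?_ ?_ ?_
  · rintro ⟨a, x, b, y⟩ h
    simp only [repsOdd, repsEvenOdd, mem_filter, mem_reps] at h ⊢
    obtain ⟨⟨⟨h1, h2, h3, h4, h5⟩, h6⟩, h7⟩ := h
    refine ⟨⟨⟨h1, by omega, by omega, h4, ?_⟩, Nat.Odd.sub_odd h6.1 h6.2, h6.2⟩, by omega⟩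
    obtain ⟨c, rfl⟩ := Nat.exists_eq_add_of_lt h7
    rw [← h5, show y + c + 1 - y = c + 1 by omega]
    ring
  · rintro ⟨a, x, b, y⟩ h
    simp only [repsOdd, repsEvenOdd, mem_filter, mem_reps] at h ⊢
    obtain ⟨⟨⟨h1, h2, h3, h4, h5⟩, h6⟩, h7⟩ := h
    refine ⟨⟨⟨h1, by omega, by omega, h4, ?_⟩, h6.1.add_odd h6.2, h6.2⟩, by omega⟩
    obtain ⟨c, rfl⟩ := Nat.exists_eq_add_of_lt h7
    rw [← h5, show a + c + 1 - a = c + 1 by omega]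
    ring
  · rintro ⟨a, x, b, y⟩ h
    simp only [mem_filter] at h
    simp only [Prod.mk.injEq, true_and, and_true]
    omega
  · rintro ⟨a, x, b, y⟩ h
    simp only [mem_filter] at h
    simp only [Prod.mk.injEq, true_and, and_true]
    omega
  · rintro ⟨a, x, b, y⟩ h
    rfl

theorem sum_repsEvenOdd_of_gt :
    ∑ t ∈ repsEvenOdd n with t.2.2.2 < t.2.1, f t.1 =
      ∑ t ∈ repsOdd n with t.1 < t.2.2.1, f t.1 := by
  refine sum_bij' (fun t _ => (t.1, t.2.1 - t.2.2.2, t.2.2.1 + t.1, t.2.2.2))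
    (fun t _ => (t.1, t.2.1 + t.2.2.2, t.2.2.1 - t.1, t.2.2.2)) ?_ ?_ ?_ ?_ ?_
  · rintro ⟨a, x, b, y⟩ h
    simp only [repsOdd, repsEvenOdd, mem_filter, mem_reps] at h ⊢
    obtain ⟨⟨⟨h1, h2, h3, h4, h5⟩, h6⟩, h7⟩ := h
    refine ⟨⟨⟨h1, by omega, by omega, h4, ?_⟩, Nat.Even.sub_odd h7.le h6.1 h6.2, h6.2⟩, by omega⟩
    obtain ⟨c, rfl⟩ := Nat.exists_eq_add_of_lt h7
    rw [← h5, show y + c + 1 - y = c + 1 by omega]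
    ring
  · rintro ⟨a, x, b, y⟩ h
    simp only [repsOdd, repsEvenOdd, mem_filter, mem_reps] at h ⊢
    obtain ⟨⟨⟨h1, h2, h3, h4, h5⟩, h6⟩, h7⟩ := h
    refine ⟨⟨⟨h1, by omega, by omega, h4, ?_⟩, h6.1.add_odd h6.2, h6.2⟩, by omega⟩
    obtain ⟨c, rfl⟩ := Nat.exists_eq_add_of_lt h7
    rw [← h5, show a + c + 1 - a = c + 1 by omega]
    ring
  · rintro ⟨a, x, b, y⟩ h
    simp only [mem_filter] at h
    simp only [Prod.mk.injEq, true_and, and_true]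
    omega
  · rintro ⟨a, x, b, y⟩ h
    simp only [mem_filter] at h
    simp only [Prod.mk.injEq, true_and, and_true]
    omega
  · rintro ⟨a, x, b, y⟩ h
    rfl

theorem sum_repsOdd_diag_fst (hn : Odd n) : ∑ t ∈ repsOdd n with t.1 = t.2.2.1, f t.1 = 0 := by
  refine sum_eq_zero ?_
  rintro ⟨a, x, b, y⟩ h
  simp only [repsOdd, mem_filter, mem_reps] at h
  obtain ⟨⟨⟨h1, h2, h3, h4, h5⟩, h6⟩, rfl⟩ := h
  rw [← h5, ← mul_add, Nat.odd_mul] at hn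
  exact absurd (h6.1.add_odd h6.2) (Nat.not_even_iff_odd.2 hn.2)

theorem sum_repsEvenOdd_diag_snd :
    ∑ t ∈ repsEvenOdd n with t.2.1 = t.2.2.2, f t.1 = 0 := by
  refine sum_eq_zero ?_
  rintro ⟨a, x, b, y⟩ h
  simp only [repsEvenOdd, mem_filter, mem_reps] at h
  obtain ⟨⟨⟨h1, h2, h3, h4, h5⟩, h6⟩, rfl⟩ := h
  exact absurd h6.1 (Nat.not_even_iff_odd.2 h6.2)

theorem sum_repsEven_diag_snd (hn : Odd n) (F : ℕ × ℕ × ℕ × ℕ → ℤ) :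
    ∑ t ∈ repsEven n with t.2.1 = t.2.2.2, F t = 0 := by
  refine sum_eq_zero ?_
  rintro ⟨a, x, b, y⟩ h
  have ho := odd_of_mem_repsEven hn (mem_filter.1 h).1
  simp only [repsEven, mem_filter] at h
  obtain ⟨⟨-, h6⟩, rfl⟩ := h
  exact absurd h6 (Nat.not_even_iff_odd.2 ho.2)

/-- On this diagonal n = a(x + y), so a is a divisor and x = 2k runs over the positive even numbers
below the odd number n/a. -/
theorem sum_repsEvenOdd_diag_fst (hn : Odd n) :
    ∑ t ∈ repsEvenOdd n with t.1 = t.2.2.1, f t.1 =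
      ∑ c ∈ n.divisors, f c * ((n / c / 2 : ℕ) : ℤ) := by
  have : ∀ c ∈ n.divisors, f c * ((n / c / 2 : ℕ) : ℤ) = ∑ _i ∈ Icc 1 (n / c / 2), f c := by
    intro c _
    simp [mul_comm]
  rw [sum_congr rfl this, sum_sigma']
  refine sum_bij' (fun t _ => ⟨t.1, t.2.1 / 2⟩)
    (fun z _ => (z.1, 2 * z.2, z.1, n / z.1 - 2 * z.2)) ?_ ?_ ?_ ?_ ?_
  · rintro ⟨a, x, b, y⟩ h
    simp only [repsEvenOdd, mem_filter, mem_reps] at h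
    obtain ⟨⟨⟨h1, h2, h3, h4, h5⟩, ⟨k, hk⟩, ⟨l, hl⟩⟩, rfl⟩ := h
    rw [← mul_add] at h5
    subst h5
    simp only [mem_sigma, Nat.mem_divisors, mem_Icc, Nat.mul_div_cancel_left _ h1]
    exact ⟨⟨dvd_mul_right _ _, by positivity⟩, by omega⟩
  · rintro ⟨c, k⟩ h
    simp only [mem_sigma, Nat.mem_divisors, mem_Icc] at h
    obtain ⟨⟨⟨e, rfl⟩, h0⟩, h1, h2⟩ := h
    have hc : 0 < c := Nat.pos_of_ne_zero (left_ne_zero_of_mul h0)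
    rw [Nat.mul_div_cancel_left _ hc] at h2
    have he := (Nat.odd_mul.1 hn).2
    have h3 : 2 * k < e := by
      obtain ⟨l, rfl⟩ := he
      omega
    simp only [repsEvenOdd, mem_filter, mem_reps, Nat.mul_div_cancel_left _ hc]
    refine ⟨⟨⟨hc, by omega, hc, by omega, ?_⟩, even_two_mul k,
      Nat.Odd.sub_even h3.le he (even_two_mul k)⟩, trivial⟩
    rw [← mul_add, Nat.add_sub_of_le h3.le]
  · rintro ⟨a, x, b, y⟩ h
    simp only [repsEvenOdd, mem_filter, mem_reps] at h
    obtain ⟨⟨⟨h1, h2, h3, h4, h5⟩, ⟨k, hk⟩, ⟨l, hl⟩⟩, rfl⟩ := h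
    rw [← mul_add] at h5
    subst h5
    simp only [Prod.mk.injEq, true_and, Nat.mul_div_cancel_left _ h1]
    omega
  · rintro ⟨c, k⟩ h
    simp
  · rintro ⟨a, x, b, y⟩ h
    rfl

/-- On this diagonal n = (a + b)x: the divisor is e = a + b, and a is free in 1 ≤ a < e. -/
theorem sum_repsOdd_diag_snd (hn : Odd n) :
    ∑ t ∈ repsOdd n with t.2.1 = t.2.2.2, f t.1 =
      ∑ e ∈ n.divisors, ∑ c ∈ Ico 1 e, f c := by
  rw [sum_sigma']
  refine sum_bij' (fun t _ => ⟨t.1 + t.2.2.1, t.1⟩)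
    (fun z _ => (z.2, n / z.1, z.1 - z.2, n / z.1)) ?_ ?_ ?_ ?_ ?_
  · rintro ⟨a, x, b, y⟩ h
    simp only [repsOdd, mem_filter, mem_reps] at h
    obtain ⟨⟨⟨h1, h2, h3, h4, h5⟩, h6⟩, rfl⟩ := h
    rw [← add_mul] at h5
    subst h5
    simp only [mem_sigma, Nat.mem_divisors, mem_Ico]
    exact ⟨⟨dvd_mul_right _ _, by positivity⟩, by omega⟩
  · rintro ⟨e, c⟩ h
    simp only [mem_sigma, Nat.mem_divisors, mem_Ico] at h
    obtain ⟨⟨⟨x, rfl⟩, h0⟩, h1, h2⟩ := h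
    have he : 0 < e := by omega
    have hx := (Nat.odd_mul.1 hn).2
    simp only [repsOdd, mem_filter, mem_reps, Nat.mul_div_cancel_left _ he]
    refine ⟨⟨⟨h1, hx.pos, by omega, hx.pos, ?_⟩, hx, hx⟩, trivial⟩
    rw [← add_mul, Nat.add_sub_of_le h2.le]
  · rintro ⟨a, x, b, y⟩ h
    simp only [repsOdd, mem_filter, mem_reps] at h
    obtain ⟨⟨⟨h1, h2, h3, h4, h5⟩, h6⟩, rfl⟩ := h
    rw [← add_mul] at h5
    subst h5
    have : 0 < a + b := by omega
    simp [Nat.mul_div_cancel_left _ this]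
  · rintro ⟨e, c⟩ h
    simp only [mem_sigma, mem_Ico] at h
    simp only [Sigma.mk.injEq, heq_eq_eq, and_true]
    omega
  · rintro ⟨a, x, b, y⟩ h
    rfl

/-- A Liouville-type identity: the difference of the sums of `f |a - b|` and of `f (a + b)` over
the representations `n = a * x + b * y` with `y` even only involves the divisors of `n`. -/
theorem sum_repsEven_dist_sub_add (hn : Odd n) (h0 : f 0 = 0) :
    ∑ t ∈ repsEven n, (f ((t.1 - t.2.2.1) + (t.2.2.1 - t.1)) - f (t.1 + t.2.2.1)) =
      ∑ c ∈ n.divisors, (f c * ((n / c / 2 : ℕ) : ℤ) - ∑ k ∈ Ico 1 c, f k) := by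
  rw [sum_sub_distrib, sum_sub_distrib, ← sum_repsEvenOdd_diag_fst f hn,
    ← sum_repsOdd_diag_snd f hn,
    sum_filter_trichotomy (repsEven n) (fun t => t.2.2.1) (fun t => t.1),
    sum_filter_trichotomy (repsEven n) (fun t => t.2.1) (fun t => t.2.2.2)
      (fun t => f (t.1 + t.2.2.1)),
    sum_repsEven_add_of_lt f hn, sum_repsEven_add_of_gt f hn, sum_repsEven_diag_snd hn]
  have e1 : ∑ t ∈ repsEven n with t.2.2.1 < t.1, f ((t.1 - t.2.2.1) + (t.2.2.1 - t.1)) =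
      ∑ t ∈ repsOdd n with t.2.1 < t.2.2.2, f t.1 := by
    rw [← sum_repsEven_sub_of_lt f hn]
    refine sum_congr rfl fun t ht => ?_
    have := (mem_filter.1 ht).2
    congr 1; omega
  have e2 : ∑ t ∈ repsEven n with t.1 < t.2.2.1, f ((t.1 - t.2.2.1) + (t.2.2.1 - t.1)) =
      ∑ t ∈ repsEvenOdd n with t.2.1 < t.2.2.2, f t.1 := by
    rw [← sum_repsEven_sub_of_gt f hn]
    refine sum_congr rfl fun t ht => ?_
    have := (mem_filter.1 ht).2
    congr 1; omega
  -- The truncated differences add up to |a - b|, which is 0 here; this is where f 0 = 0 enters.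
  have e3 : ∑ t ∈ repsEven n with t.2.2.1 = t.1, f ((t.1 - t.2.2.1) + (t.2.2.1 - t.1)) = 0 := by
    refine sum_eq_zero fun t ht => ?_
    simp [(mem_filter.1 ht).2, h0]
  rw [e1, e2, e3]
  -- Split each of the two parity classes once by comparing x with y and once by comparing a with b.
  -- The off-diagonal parts cancel through the class-swapping bijections, leaving the diagonal a = b
  -- of the even-odd class minus the diagonal x = y of the odd class.
  have o1 := sum_filter_trichotomy (repsOdd n) (fun t => t.2.1) (fun t => t.2.2.2) (fun t => f t.1)
  have o2 := sum_filter_trichotomy (repsOdd n) (fun t => t.1) (fun t => t.2.2.1) (fun t => f t.1)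
  have o3 := sum_filter_trichotomy (repsEvenOdd n) (fun t => t.2.1) (fun t => t.2.2.2)
    (fun t => f t.1)
  have o4 := sum_filter_trichotomy (repsEvenOdd n) (fun t => t.1) (fun t => t.2.2.1)
    (fun t => f t.1)
  rw [sum_repsOdd_of_gt f] at o1
  rw [sum_repsOdd_diag_fst f hn] at o2
  rw [sum_repsEvenOdd_of_gt f, sum_repsEvenOdd_diag_snd f] at o3
  linarith

theorem sum_Ico_neg_one_pow_mul_sq (m : ℕ) :
    ∑ c ∈ Ico 1 (2 * m + 1), (-1 : ℤ) ^ c * (c : ℤ) ^ 2 = (2 * m + 1) * m := by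
  induction m with
  | zero => simp
  | succ k ih =>
    rw [show 2 * (k + 1) + 1 = 2 * k + 1 + 1 + 1 by ring, sum_Ico_succ_top (by omega),
      sum_Ico_succ_top (by omega), ih]
    have e1 : (-1 : ℤ) ^ (2 * k + 1) = -1 := Odd.neg_one_pow ⟨k, rfl⟩
    have e2 : (-1 : ℤ) ^ (2 * k + 1 + 1) = 1 := Even.neg_one_pow ⟨k + 1, by ring⟩
    rw [e1, e2]
    push_cast
    ring

/-- Take f(c) = (-1)^c c² in the Liouville identity: |a - b| and a + b have the same parity, and (a
- b)² - (a + b)² = -4ab. -/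
theorem sum_repsEven_mul (hn : Odd n) :
    8 * ∑ t ∈ repsEven n, (-1 : ℤ) ^ (t.1 + t.2.2.1) * (t.1 * t.2.2.1) =
      (n - 1) * (ArithmeticFunction.sigma 1 n : ℤ) := by
  have key := sum_repsEven_dist_sub_add (fun c => (-1 : ℤ) ^ c * (c : ℤ) ^ 2) hn (by simp)
  have e1 : ∀ t ∈ repsEven n, (-1 : ℤ) ^ (t.1 - t.2.2.1 + (t.2.2.1 - t.1)) *
      ((t.1 - t.2.2.1 + (t.2.2.1 - t.1) : ℕ) : ℤ) ^ 2 - (-1 : ℤ) ^ (t.1 + t.2.2.1) *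
      ((t.1 + t.2.2.1 : ℕ) : ℤ) ^ 2 = -4 * ((-1 : ℤ) ^ (t.1 + t.2.2.1) * (t.1 * t.2.2.1)) := by
    rintro ⟨a, x, b, y⟩ -
    dsimp only
    rcases le_total a b with h | h
    · obtain ⟨k, rfl⟩ := Nat.exists_eq_add_of_le h
      rw [show a - (a + k) + (a + k - a) = k by omega, show a + (a + k) = k + 2 * a by ring,
        pow_add, pow_mul]
      push_cast
      simp only [one_pow]
      ring
    · obtain ⟨k, rfl⟩ := Nat.exists_eq_add_of_le h
      rw [show b + k - b + (b - (b + k)) = k by omega, show b + k + b = k + 2 * b by ring,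
        pow_add, pow_mul]
      push_cast
      simp only [one_pow]
      ring
  -- With n = ce and both factors odd, the left side is -c²(e - 1)/2 - c(c - 1)/2 = -c(n - 1)/2.
  have e2 : ∀ c ∈ n.divisors, (-1 : ℤ) ^ c * (c : ℤ) ^ 2 * ((n / c / 2 : ℕ) : ℤ) -
      ∑ k ∈ Ico 1 c, (-1 : ℤ) ^ k * (k : ℤ) ^ 2 = - (((n - 1) / 2 : ℕ) : ℤ) * c := by
    intro c hc
    obtain ⟨⟨e, rfl⟩, h0⟩ := Nat.mem_divisors.1 hc
    obtain ⟨⟨k, rfl⟩, ⟨l, rfl⟩⟩ := Nat.odd_mul.1 hn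
    rw [Nat.mul_div_cancel_left _ (by omega), sum_Ico_neg_one_pow_mul_sq,
      show (2 * l + 1) / 2 = l by omega, Odd.neg_one_pow ⟨k, rfl⟩,
      show ((2 * k + 1) * (2 * l + 1) - 1) / 2 = 2 * k * l + k + l by
        rw [show (2 * k + 1) * (2 * l + 1) - 1 = 2 * (2 * k * l + k + l) by
          rw [Nat.sub_eq_iff_eq_add (Nat.mul_pos (by omega) (by omega))]; ring]
        omega]
    push_cast
    ring
  rw [sum_congr rfl e1, sum_congr rfl e2, ← mul_sum, ← mul_sum] at key
  rw [ArithmeticFunction.sigma_one_apply]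
  push_cast
  obtain ⟨k, rfl⟩ := hn
  rw [show (2 * k + 1 - 1) / 2 = k by omega] at key
  push_cast
  linarith

end PrimePower

end

/-! ### The coefficients a and b through σ₁, and the convolution formula -/

noncomputable section

namespace PrimePower

open Finset

open scoped ArithmeticFunction.sigma

/-- The sequence supported on the multiples of `d` with `dilate d c (d * n) = c n`. -/
def dilate (d : ℕ) (c : ℕ → ℝ) (n : ℕ) : ℝ := if d ∣ n then c (n / d) else 0

theorem dilate_mul {d : ℕ} (hd : 0 < d) (c : ℕ → ℝ) (n : ℕ) : dilate d c (d * n) = c n := by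
  simp [dilate, Nat.mul_div_cancel_left _ hd]

/-- The divisor sum `σ₁` as a real sequence. -/
def sigmaR (n : ℕ) : ℝ := (σ 1 n : ℝ)

/-- The alternating divisor sum `∑ (-1) ^ (b - 1) * b` over the factorizations `n = b * y` with
`y` even. -/
def altSigma (n : ℕ) : ℤ :=
  ∑ q ∈ n.divisorsAntidiagonal, if Even q.2 then (-1) ^ (q.1 + 1) * (q.1 : ℤ) else 0

/-- This is σ₁(2^m k) = (2^(m+1) - 1) σ₁(k), written additively to avoid subtraction in ℕ. -/
theorem sigma_two_pow_mul (m : ℕ) {k : ℕ} (hk : Odd k) :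
    σ 1 (2 ^ m * k) + σ 1 k = 2 ^ (m + 1) * σ 1 k := by
  have hc : (2 ^ m).Coprime k := (Nat.coprime_two_left.2 hk).pow_left m
  rw [ArithmeticFunction.isMultiplicative_sigma.map_mul_of_coprime hc,
    ArithmeticFunction.sigma_one_apply_prime_pow Nat.prime_two, Nat.geomSum_eq le_rfl]
  have : 0 < 2 ^ (m + 1) := by positivity
  obtain ⟨r, hr⟩ := Nat.exists_eq_add_of_lt this
  rw [hr]
  simp
  ring

theorem a_two_pow_mul (m : ℕ) {k : ℕ} (hk : Odd k) : a (2 ^ m * k) = 2 ^ m * σ 1 k := by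
  rw [a_mul ((Nat.coprime_two_left.2 hk).pow_left m), a_two_pow, a_odd hk]

theorem dilate_odd {d n : ℕ} (hd : Even d) (hn : Odd n) (c : ℕ → ℝ) : dilate d c n = 0 := by
  refine if_neg fun h => ?_
  exact hn.not_two_dvd_nat (hd.two_dvd.trans h)

theorem a_eq_sigmaR_sub (n : ℕ) : (a n : ℝ) = sigmaR n - dilate 2 sigmaR n := by
  rcases eq_or_ne n 0 with rfl | hn
  · simp [a, sigmaR, dilate]
  obtain ⟨m, k, hk, rfl⟩ := Nat.exists_eq_two_pow_mul_odd hn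
  rw [a_two_pow_mul m hk]
  rcases m with _ | m
  · rw [dilate_odd even_two (by simpa using hk)]
    simp [sigmaR]
  · have h1 := sigma_two_pow_mul (m + 1) hk
    have h2 := sigma_two_pow_mul m hk
    rw [show 2 ^ (m + 1) * k = 2 * (2 ^ m * k) by ring, dilate_mul two_pos,
      show 2 * (2 ^ m * k) = 2 ^ (m + 1) * k by ring]
    unfold sigmaR
    have h1' : (σ 1 (2 ^ (m + 1) * k) : ℝ) + σ 1 k = 2 ^ (m + 1 + 1) * σ 1 k := by exact_mod_cast h1
    have h2' : (σ 1 (2 ^ m * k) : ℝ) + σ 1 k = 2 ^ (m + 1) * σ 1 k := by exact_mod_cast h2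
    push_cast
    rw [pow_succ _ (m + 1)] at h1'
    linarith

/-- For fixed odd k, σ₁(2^m k) is a combination of 2^m and 1, and 1 - 3X + 2X² = (1 - X)(1 - 2X)
annihilates both once m ≥ 2; m = 0 and m = 1 are boundary cases. -/
theorem b_eq_sigmaR_sub (n : ℕ) :
    (b n : ℝ) = sigmaR n - 3 * dilate 2 sigmaR n + 2 * dilate 4 sigmaR n := by
  rcases eq_or_ne n 0 with rfl | hn
  · simp [b, sigmaR, dilate]
  obtain ⟨m, k, hk, rfl⟩ := Nat.exists_eq_two_pow_mul_odd hn
  rcases m with _ | _ | m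
  · have ho : Odd (2 ^ 0 * k) := by simpa using hk
    rw [dilate_odd even_two ho, dilate_odd (by decide) ho, b_odd ho]
    simp [sigmaR]
  · have h1 := sigma_two_pow_mul 1 hk
    have h4 : ¬ 4 ∣ 2 ^ (0 + 1) * k := by
      obtain ⟨r, rfl⟩ := hk
      omega
    rw [show b (2 ^ (0 + 1) * k) = 0 from if_neg (by simp), show 2 ^ (0 + 1) * k = 2 * k by ring,
      dilate_mul two_pos, dilate, if_neg (by simpa using h4)]
    unfold sigmaR
    have h1' : (σ 1 (2 * k) : ℝ) + σ 1 k = 2 ^ (1 + 1) * σ 1 k := by exact_mod_cast h1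
    norm_num at h1' ⊢
    linarith
  · have h1 := sigma_two_pow_mul (m + 2) hk
    have h2 := sigma_two_pow_mul (m + 1) hk
    have h3 := sigma_two_pow_mul m hk
    rw [show b (2 ^ (m + 1 + 1) * k) = 0 from if_neg (by simp [parity_simps])]
    have e2 : dilate 2 sigmaR (2 ^ (m + 1 + 1) * k) = sigmaR (2 ^ (m + 1) * k) := by
      rw [← dilate_mul two_pos sigmaR]
      congr 1; ring
    have e4 : dilate 4 sigmaR (2 ^ (m + 1 + 1) * k) = sigmaR (2 ^ m * k) := by
      rw [← dilate_mul four_pos sigmaR]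
      congr 1; ring
    rw [e2, e4]
    unfold sigmaR
    have h1' : (σ 1 (2 ^ (m + 2) * k) : ℝ) + σ 1 k = 2 ^ (m + 2 + 1) * σ 1 k := by
      exact_mod_cast h1
    have h2' : (σ 1 (2 ^ (m + 1) * k) : ℝ) + σ 1 k = 2 ^ (m + 1 + 1) * σ 1 k := by
      exact_mod_cast h2
    have h3' : (σ 1 (2 ^ m * k) : ℝ) + σ 1 k = 2 ^ (m + 1) * σ 1 k := by exact_mod_cast h3
    rw [show m + 1 + 1 = m + 2 by ring]
    push_cast
    ring_nf at h1' h2' h3' ⊢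
    linarith

theorem altSigma_odd {n : ℕ} (hn : Odd n) : altSigma n = 0 := by
  refine sum_eq_zero fun q hq => if_neg fun h => ?_
  rw [← (Nat.mem_divisorsAntidiagonal.1 hq).1] at hn
  exact Nat.not_even_iff_odd.2 (Nat.odd_mul.1 hn).2 h

theorem altSigma_two_mul (m : ℕ) :
    altSigma (2 * m) = ∑ b ∈ m.divisors, (-1) ^ (b + 1) * (b : ℤ) := by
  rw [altSigma, ← sum_filter]
  refine sum_bij' (fun q _ => q.1) (fun b _ => (b, 2 * (m / b))) ?_ ?_ ?_ ?_ ?_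
  · rintro ⟨b, y⟩ h
    simp only [mem_filter, Nat.mem_divisorsAntidiagonal] at h
    obtain ⟨⟨h1, h2⟩, ⟨k, rfl⟩⟩ := h
    rw [Nat.mem_divisors]
    exact ⟨⟨k, by linarith⟩, by omega⟩
  · intro b h
    obtain ⟨⟨k, rfl⟩, h2⟩ := Nat.mem_divisors.1 h
    simp only [mem_filter, Nat.mem_divisorsAntidiagonal]
    rw [Nat.mul_div_cancel_left _ (Nat.pos_of_ne_zero (left_ne_zero_of_mul h2))]
    exact ⟨⟨by ring, by omega⟩, even_two_mul k⟩
  · rintro ⟨b, y⟩ h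
    simp only [mem_filter, Nat.mem_divisorsAntidiagonal] at h
    obtain ⟨⟨h1, h2⟩, ⟨k, rfl⟩⟩ := h
    have hb : 0 < b := by
      rcases Nat.eq_zero_or_pos b with rfl | hb
      · omega
      · exact hb
    have : m = b * k := by linarith
    simp only [this, Nat.mul_div_cancel_left _ hb, two_mul]
  · intro b h
    rfl
  · rintro ⟨b, y⟩ h
    rfl

/-- For n = 2m, flipping the sign of the even divisors of m subtracts twice their sum, and that sum
is 2 σ₁(m/2), or 0 if m is odd. -/
theorem altSigma_eq (n : ℕ) :
    (altSigma n : ℝ) = dilate 2 sigmaR n - 4 * dilate 4 sigmaR n := by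
  rcases Nat.even_or_odd' n with ⟨m, rfl | rfl⟩
  · rw [altSigma_two_mul, dilate_mul two_pos]
    have e : dilate 4 sigmaR (2 * m) = dilate 2 sigmaR m := by
      simp only [dilate, show 4 = 2 * 2 by rfl, Nat.mul_dvd_mul_iff_left two_pos,
        Nat.mul_div_mul_left _ _ two_pos]
    rw [e]
    have h1 : ∀ b ∈ m.divisors, (((-1) ^ (b + 1) * (b : ℤ) : ℤ) : ℝ) =
        b - if Even b then 2 * (b : ℝ) else 0 := by
      intro b _
      split_ifs with hb
      · rw [Odd.neg_one_pow hb.add_one]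
        push_cast
        ring
      · rw [Even.neg_one_pow (Nat.not_even_iff_odd.1 hb).add_one]
        push_cast
        ring
    rw [Int.cast_sum, sum_congr rfl h1, sum_sub_distrib, ← sum_filter, ← mul_sum]
    have h2 : sigmaR m = ∑ b ∈ m.divisors, (b : ℝ) := by
      simp [sigmaR, ArithmeticFunction.sigma_one_apply]
    have h3 : ∑ b ∈ m.divisors with Even b, (b : ℝ) = 2 * dilate 2 sigmaR m := by
      unfold dilate
      split_ifs with hm
      · obtain ⟨r, rfl⟩ := hm
        rw [Nat.mul_div_cancel_left _ two_pos]
        simp only [sigmaR, ArithmeticFunction.sigma_one_apply, Nat.cast_sum, mul_sum]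
        refine sum_bij' (fun b _ => b / 2) (fun b _ => 2 * b) ?_ ?_ ?_ ?_ ?_
        · intro b hb
          simp only [mem_filter, Nat.mem_divisors] at hb
          obtain ⟨⟨h1, h2⟩, ⟨k, rfl⟩⟩ := hb
          rw [Nat.mem_divisors, show (k + k) / 2 = k by omega]
          rw [← two_mul] at h1
          exact ⟨(Nat.mul_dvd_mul_iff_left two_pos).1 h1, by omega⟩
        · intro b hb
          simp only [mem_filter, Nat.mem_divisors] at hb ⊢
          exact ⟨⟨Nat.mul_dvd_mul_left 2 hb.1, by omega⟩, even_two_mul b⟩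
        · intro b hb
          exact Nat.two_mul_div_two_of_even (mem_filter.1 hb).2
        · intro b hb
          exact Nat.mul_div_cancel_left b two_pos
        · intro b hb
          have := Nat.two_mul_div_two_of_even (mem_filter.1 hb).2
          exact_mod_cast this.symm
      · rw [mul_zero]
        refine sum_eq_zero fun b hb => ?_
        simp only [mem_filter, Nat.mem_divisors] at hb
        exact absurd (hb.2.two_dvd.trans hb.1.1) hm
    rw [h2, h3]
    ring
  · have ho : Odd (2 * m + 1) := odd_two_mul_add_one m
    rw [altSigma_odd ho, dilate_odd even_two ho, dilate_odd (by decide) ho]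
    simp

/-- The coefficient form of the logarithmic derivative of B. For even n both sides vanish by parity;
for odd n it is `sum_repsEven_mul`. -/
theorem sum_antidiagonal_b_mul_altSigma (n : ℕ) :
    8 * ∑ p ∈ antidiagonal n, (b p.1 : ℤ) * altSigma p.2 = (n - 1) * (b n : ℤ) := by
  rcases Nat.even_or_odd n with hn | hn
  · rw [show b n = 0 from if_neg (Nat.not_odd_iff_even.2 hn)]
    rw [sum_eq_zero]
    · simp
    · intro p hp
      rw [HasAntidiagonal.mem_antidiagonal] at hp
      rcases Nat.even_or_odd p.1 with h | h
      · rw [show b p.1 = 0 from if_neg (Nat.not_odd_iff_even.2 h)]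
        simp
      · rw [altSigma_odd, mul_zero]
        subst hp
        exact Nat.not_even_iff_odd.1 fun h' =>
          Nat.not_even_iff_odd.2 (h.add_even h') hn
  · have e : ∀ p ∈ antidiagonal n, (b p.1 : ℤ) * altSigma p.2 =
        (∑ q ∈ p.1.divisorsAntidiagonal, (q.1 : ℤ)) * ∑ r ∈ p.2.divisorsAntidiagonal,
          if Even r.2 then (-1) ^ (r.1 + 1) * (r.1 : ℤ) else 0 := by
      intro p hp
      rw [HasAntidiagonal.mem_antidiagonal] at hp
      rcases Nat.even_or_odd p.1 with h | h
      · have : altSigma p.2 = 0 := by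
          refine altSigma_odd ?_
          subst hp
          exact (Nat.odd_add'.1 hn).2 h
        rw [this, mul_zero]
        exact (mul_eq_zero_of_right _ this).symm
      · rw [b_odd h, ArithmeticFunction.sigma_one_apply,
          Nat.sum_divisorsAntidiagonal (fun d _ => (d : ℤ))]
        simp [altSigma]
    rw [sum_congr rfl e, sum_antidiagonal_mul_sum_divisorsAntidiagonal, b_odd hn,
      ← sum_repsEven_mul hn, repsEven, sum_filter]
    congr 1
    refine sum_congr rfl ?_
    rintro ⟨c, x, d, y⟩ ht
    dsimp only
    split_ifs with hy
    -- Since c is odd, (-1)^(c + d) = (-1)^(d + 1).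
    · have := (odd_of_mem_repsEven hn (mem_filter.2 ⟨ht, hy⟩)).1
      rw [pow_add _ c d, this.neg_one_pow, pow_succ]
      ring
    · simp

theorem a_le_sq (n : ℕ) : a n ≤ n ^ 2 := by
  have h1 : 2 ^ n.factorization 2 * (n / 2 ^ n.factorization 2) = n :=
    Nat.ordProj_mul_ordCompl_eq_self n 2
  unfold a
  calc 2 ^ n.factorization 2 * σ 1 (n / 2 ^ n.factorization 2)
      ≤ 2 ^ n.factorization 2 * (n / 2 ^ n.factorization 2) ^ 2 :=
        Nat.mul_le_mul_left _ (ArithmeticFunction.sigma_le_pow_succ 1 _)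
    _ ≤ (2 ^ n.factorization 2) ^ 2 * (n / 2 ^ n.factorization 2) ^ 2 :=
        Nat.mul_le_mul_right _ (Nat.le_self_pow two_ne_zero _)
    _ = n ^ 2 := by rw [← mul_pow, h1]

theorem b_le_sq (n : ℕ) : b n ≤ n ^ 2 := by
  unfold b
  split_ifs
  · exact ArithmeticFunction.sigma_le_pow_succ 1 _
  · exact Nat.zero_le _

theorem sigmaR_le_sq (n : ℕ) : |sigmaR n| ≤ (n : ℝ) ^ 2 := by
  rw [sigmaR, abs_of_nonneg (Nat.cast_nonneg _)]
  exact_mod_cast ArithmeticFunction.sigma_le_pow_succ 1 n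

theorem abs_altSigma_le (n : ℕ) : |(altSigma n : ℝ)| ≤ (n : ℝ) ^ 2 := by
  refine le_trans ?_ (sigmaR_le_sq n)
  have h : |altSigma n| ≤ (σ 1 n : ℤ) := by
    refine (abs_sum_le_sum_abs _ _).trans ?_
    rw [ArithmeticFunction.sigma_one_apply, Nat.cast_sum,
      ← Nat.sum_divisorsAntidiagonal (fun d _ => (d : ℤ))]
    refine sum_le_sum fun q _ => ?_
    split_ifs
    · simp [abs_mul]
    · simp
  rw [sigmaR, abs_of_nonneg (Nat.cast_nonneg _ : (0 : ℝ) ≤ _)]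
  exact_mod_cast h

end PrimePower

end

/-! ### Exponential series with polynomially bounded coefficients -/

noncomputable section

namespace PrimePower

open Finset Filter Topology

open scoped ArithmeticFunction.sigma

/-- The series `∑ c n * exp (-π n x)`. -/
def expSeries (c : ℕ → ℝ) (x : ℝ) : ℝ := ∑' n, c n * Real.exp (-Real.pi * n * x)

section expSeries

variable {c : ℕ → ℝ} {k : ℕ}

theorem summable_norm_expSeries (hc : ∀ n, |c n| ≤ (n : ℝ) ^ k) {x : ℝ} (hx : 0 < x) :
    Summable fun n => ‖c n * Real.exp (-Real.pi * n * x)‖ := by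
  refine Summable.of_nonneg_of_le (fun n => norm_nonneg _) (fun n => ?_)
    (Real.summable_pow_mul_exp_neg_nat_mul k (mul_pos Real.pi_pos hx))
  rw [norm_mul, Real.norm_eq_abs, Real.norm_eq_abs, Real.abs_exp,
    show -Real.pi * n * x = -(Real.pi * x) * n by ring]
  exact mul_le_mul_of_nonneg_right (hc n) (Real.exp_nonneg _)

theorem hasSum_expSeries (hc : ∀ n, |c n| ≤ (n : ℝ) ^ k) {x : ℝ} (hx : 0 < x) :
    HasSum (fun n => c n * Real.exp (-Real.pi * n * x)) (expSeries c x) :=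
  (summable_norm_expSeries hc hx).of_norm.hasSum

theorem hasSum_expSeries_dilate (hc : ∀ n, |c n| ≤ (n : ℝ) ^ k) {d : ℕ} (hd : 0 < d) {x : ℝ}
    (hx : 0 < x) :
    HasSum (fun n => dilate d c n * Real.exp (-Real.pi * n * x)) (expSeries c (d * x)) := by
  have hd' : (0 : ℝ) < d := Nat.cast_pos.2 hd
  have h := hasSum_expSeries hc (mul_pos hd' hx)
  have hi : Function.Injective fun n : ℕ => d * n := fun m n h => Nat.eq_of_mul_eq_mul_left hd h
  rw [← hi.hasSum_iff]
  · refine h.congr_fun fun n => ?_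
    simp only [Function.comp_apply, dilate_mul hd, Nat.cast_mul]
    congr 2
    ring
  · intro n hn
    have : ¬ d ∣ n := fun ⟨m, hm⟩ => hn ⟨m, hm.symm⟩
    simp [dilate, this]

theorem continuousOn_expSeries (hc : ∀ n, |c n| ≤ (n : ℝ) ^ k) :
    ContinuousOn (expSeries c) (Set.Ioi 0) := by
  intro x hx
  have hx' : 0 < x / 2 := half_pos hx
  have h : ContinuousOn (expSeries c) (Set.Ioi (x / 2)) := by
    refine continuousOn_tsum (fun n => by fun_prop) (summable_norm_expSeries hc hx') ?_
    intro n y hy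
    rw [norm_mul, norm_mul]
    refine mul_le_mul_of_nonneg_left ?_ (norm_nonneg _)
    rw [Real.norm_eq_abs, Real.norm_eq_abs, Real.abs_exp, Real.abs_exp, Real.exp_le_exp]
    have h1 : 0 ≤ Real.pi * n := by positivity
    nlinarith [mul_le_mul_of_nonneg_left (Set.mem_Ioi.1 hy).le h1]
  exact (h.continuousAt (Ioi_mem_nhds (half_lt_self hx))).continuousWithinAt

theorem expSeries_mul_expSeries {c' : ℕ → ℝ} {k' : ℕ} (hc : ∀ n, |c n| ≤ (n : ℝ) ^ k)
    (hc' : ∀ n, |c' n| ≤ (n : ℝ) ^ k') {x : ℝ} (hx : 0 < x) :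
    expSeries c x * expSeries c' x =
      expSeries (fun n => ∑ p ∈ antidiagonal n, c p.1 * c' p.2) x := by
  unfold expSeries
  rw [tsum_mul_tsum_eq_tsum_sum_antidiagonal_of_summable_norm (summable_norm_expSeries hc hx)
    (summable_norm_expSeries hc' hx)]
  refine tsum_congr fun n => ?_
  rw [sum_mul]
  refine sum_congr rfl fun p hp => ?_
  rw [← (HasAntidiagonal.mem_antidiagonal.1 hp), Nat.cast_add,
    show -Real.pi * ((p.1 : ℝ) + p.2) * x = -Real.pi * p.1 * x + -Real.pi * p.2 * x by ring,
    Real.exp_add]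
  ring

end expSeries

/-! ### The weight 2 Eisenstein series and the product A(1/x) B(x) -/

/-- The series `∑ σ₁(n) exp (-π n x)`. -/
def seriesSigma : ℝ → ℝ := expSeries sigmaR

/-- The series `∑ a(n) exp (-π n x)`. -/
def seriesA : ℝ → ℝ := expSeries fun n => a n

/-- The series `∑ b(n) exp (-π n x)`. -/
def seriesB : ℝ → ℝ := expSeries fun n => b n

/-- The series `∑ n b(n) exp (-π n x)`. -/
def seriesNB : ℝ → ℝ := expSeries fun n => n * b n

theorem abs_a_le (n : ℕ) : |(a n : ℝ)| ≤ (n : ℝ) ^ 2 := by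
  rw [Nat.abs_cast]
  exact_mod_cast a_le_sq n

theorem abs_b_le (n : ℕ) : |(b n : ℝ)| ≤ (n : ℝ) ^ 2 := by
  rw [Nat.abs_cast]
  exact_mod_cast b_le_sq n

theorem abs_nat_mul_b_le (n : ℕ) : |(n * b n : ℝ)| ≤ (n : ℝ) ^ 3 := by
  rw [abs_mul, Nat.abs_cast, pow_succ', Nat.abs_cast]
  exact mul_le_mul_of_nonneg_left (by exact_mod_cast b_le_sq n) (Nat.cast_nonneg n)

theorem seriesA_eq {x : ℝ} (hx : 0 < x) : seriesA x = seriesSigma x - seriesSigma (2 * x) := by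
  have h2 := hasSum_expSeries_dilate sigmaR_le_sq two_pos hx
  refine (hasSum_expSeries abs_a_le hx).unique
    (((hasSum_expSeries sigmaR_le_sq hx).sub h2).congr_fun fun n => ?_)
  rw [a_eq_sigmaR_sub]
  ring

/-- The convolution formula says that the series of n b(n) minus B is 8 B times the series of
`altSigma`, and the latter is S(2x) - 4 S(4x). -/
theorem seriesNB_eq {x : ℝ} (hx : 0 < x) :
    seriesNB x = (1 + 8 * seriesSigma (2 * x) - 32 * seriesSigma (4 * x)) * seriesB x := by
  have h2 := hasSum_expSeries_dilate sigmaR_le_sq two_pos hx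
  have h4 := hasSum_expSeries_dilate sigmaR_le_sq four_pos hx
  have hw : expSeries (fun n => altSigma n) x = seriesSigma (2 * x) - 4 * seriesSigma (4 * x) := by
    refine (hasSum_expSeries abs_altSigma_le hx).unique
      ((h2.sub (h4.mul_left 4)).congr_fun fun n => ?_)
    rw [altSigma_eq]
    ring
  have hp := expSeries_mul_expSeries abs_b_le abs_altSigma_le hx
  have hs : seriesB x * expSeries (fun n => altSigma n) x = (seriesNB x - seriesB x) / 8 := by
    refine hp.trans (HasSum.tsum_eq ((((hasSum_expSeries abs_nat_mul_b_le hx).sub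
      (hasSum_expSeries abs_b_le hx)).div_const 8).congr_fun fun n => ?_))
    have h' : 8 * ∑ p ∈ antidiagonal n, (b p.1 : ℝ) * altSigma p.2 = (n - 1) * (b n : ℝ) := by
      exact_mod_cast sum_antidiagonal_b_mul_altSigma n
    rw [← sub_mul, mul_div_right_comm]
    congr 1
    linarith
  rw [hw] at hs
  linarith

open EisensteinSeries in
theorem G2_eq_seriesSigma {x : ℝ} (hx : 0 < x) {z : UpperHalfPlane}
    (hz : (z : ℂ) = Complex.I * (x / 2)) :
    G2 z = Real.pi ^ 2 / 3 * (1 - 24 * (seriesSigma x : ℂ)) := by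
  have h : (seriesSigma x : ℂ) =
      ∑' n : ℕ+, (σ 1 n : ℂ) * Complex.exp (2 * Real.pi * Complex.I * z) ^ (n : ℕ) := by
    have h0 : seriesSigma x = ∑' n : ℕ+, sigmaR n * Real.exp (-Real.pi * n * x) := by
      rw [tsum_pnat_eq_tsum_succ (f := fun n : ℕ => sigmaR n * Real.exp (-Real.pi * n * x))]
      have := (hasSum_expSeries sigmaR_le_sq hx).summable.tsum_eq_zero_add
      simpa [sigmaR, seriesSigma, expSeries] using this
    rw [h0, Complex.ofReal_tsum]
    refine tsum_congr fun n => ?_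
    rw [Complex.ofReal_mul, Complex.ofReal_exp, ← Complex.exp_nat_mul, hz, sigmaR]
    congr 1
    congr 1
    push_cast
    linear_combination (-(Real.pi : ℂ) * n * x) * Complex.I_sq
  rw [G2_eq_tsum_cexp, ← h, riemannZeta_two]
  ring

/-- At z = ix/2 the nome e^(2πiz) is e^(-πx), and -1/z = i(4/x)/2. The term 12/(πx) is the
quasimodular correction of the weight 2 series. -/
theorem seriesSigma_four_div {x : ℝ} (hx : 0 < x) :
    1 - 24 * seriesSigma x =
      -(4 / x ^ 2) * (1 - 24 * seriesSigma (4 / x)) + 12 / (Real.pi * x) := by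
  have hxc : (x : ℂ) ≠ 0 := Complex.ofReal_ne_zero.2 hx.ne'
  have hpi : (Real.pi : ℂ) ≠ 0 := Complex.ofReal_ne_zero.2 Real.pi_ne_zero
  let z : UpperHalfPlane := ⟨Complex.I * (x / 2), by simpa using hx⟩
  have hz : (z : ℂ) = Complex.I * (x / 2) := rfl
  have hS : ((ModularGroup.S • z : UpperHalfPlane) : ℂ) = Complex.I * ((4 / x : ℝ) / 2) := by
    rw [UpperHalfPlane.modular_S_smul]
    change (-(Complex.I * (x / 2)))⁻¹ = _
    refine inv_eq_of_mul_eq_one_right ?_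
    push_cast
    field_simp
    linear_combination (-4 : ℂ) * Complex.I_sq
  have h := EisensteinSeries.G2_S_transform z
  rw [G2_eq_seriesSigma hx hz, G2_eq_seriesSigma (by positivity) hS, hz] at h
  have h2 : (1 - 24 * (seriesSigma x : ℂ)) =
      -(4 / x ^ 2) * (1 - 24 * (seriesSigma (4 / x) : ℂ)) + 12 / (Real.pi * x) := by
    rw [mul_pow, Complex.I_sq] at h
    field_simp at h ⊢
    linear_combination h
  exact_mod_cast h2

/-- The relation between the values of the series `A` at `1 / x` and the series `B` at `x`. -/
theorem seriesA_inv_mul_seriesB {x : ℝ} (hx : 0 < x) :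
    seriesA x⁻¹ * seriesB x = x ^ 2 / 8 * seriesNB x - x / (4 * Real.pi) * seriesB x := by
  have h1 := seriesSigma_four_div (inv_pos.2 hx)
  have h2 := seriesSigma_four_div (mul_pos two_pos (inv_pos.2 hx))
  rw [show 4 / x⁻¹ = 4 * x by field_simp] at h1
  rw [show 4 / (2 * x⁻¹) = 2 * x by field_simp; ring] at h2
  rw [seriesA_eq (inv_pos.2 hx), seriesNB_eq hx]
  -- The transformation law at 1/x and at 2/x brings in S(4x) and S(2x), in exactly the combination
  -- of `seriesNB_eq`.
  have h3 : seriesSigma x⁻¹ - seriesSigma (2 * x⁻¹) =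
      x ^ 2 / 8 * (1 + 8 * seriesSigma (2 * x) - 32 * seriesSigma (4 * x)) -
        x / (4 * Real.pi) := by
    have hpi := Real.pi_ne_zero
    field_simp at h1 h2 ⊢
    linarith
  rw [h3]
  ring

end PrimePower

end

/-! ### Decay of A(y) B(1/y) and its entire Mellin transform -/

noncomputable section

namespace PrimePower

open Finset Filter Topology MeasureTheory Complex Asymptotics

open scoped ArithmeticFunction.sigma

/-- The term `a(d) b(m) exp (-π (d y + m / y))`. -/
def productTerm (y : ℝ) (p : ℕ × ℕ) : ℝ :=
  (a p.1 * Real.exp (-Real.pi * p.1 * y)) * (b p.2 * Real.exp (-Real.pi * p.2 * y⁻¹))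

/-- The product `A(y) B(1 / y)` of the two exponential series. -/
def productSeries (y : ℝ) : ℝ := seriesA y * seriesB y⁻¹

/-- The function `exp (-(π / 2) (y + 1 / y))`, a bound for `A(y) B(1 / y)` up to a constant. -/
def decay (y : ℝ) : ℝ := Real.exp (-(Real.pi / 2) * (y + y⁻¹))

theorem hasSum_productTerm {y : ℝ} (hy : 0 < y) : HasSum (productTerm y) (productSeries y) := by
  have hy' : 0 < y⁻¹ := inv_pos.2 hy
  exact (hasSum_expSeries abs_a_le hy).mul (hasSum_expSeries abs_b_le hy')
    (summable_mul_of_summable_norm (summable_norm_expSeries abs_a_le hy)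
      (summable_norm_expSeries abs_b_le hy'))

theorem exp_neg_le {u : ℝ} (hu : 0 < u) : Real.exp (-u) ≤ 24 / u ^ 4 := by
  have h := Real.pow_div_factorial_le_exp u hu.le 4
  rw [Real.exp_neg, ← inv_div]
  refine inv_anti₀ (by positivity) ?_
  simpa [Nat.factorial] using h

/-- Half of the exponent yields `decay`, because d, m ≥ 1. The other half is bounded by fourth
powers in which y cancels; these absorb the quadratic growth of a and b and leave a summable bound,
with 576 = 24². -/
theorem abs_productTerm_le {y : ℝ} (hy : 0 < y) (p : ℕ × ℕ) :
    |productTerm y p| ≤ 1 / (p.1 : ℝ) ^ 2 * (1 / (p.2 : ℝ) ^ 2) * (576 * decay y) := by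
  obtain ⟨d, m⟩ := p
  rcases Nat.eq_zero_or_pos d with rfl | hd
  · simp [productTerm, a]
  rcases Nat.eq_zero_or_pos m with rfl | hm
  · simp [productTerm, b]
  have hd1 : (1 : ℝ) ≤ d := by exact_mod_cast hd
  have hm1 : (1 : ℝ) ≤ m := by exact_mod_cast hm
  have hy' : 0 < y⁻¹ := inv_pos.2 hy
  have hpi := Real.pi_pos
  have hpi2 : 2 ≤ Real.pi := Real.two_le_pi
  dsimp only [productTerm]
  have e1 : Real.exp (-Real.pi * d * y) * Real.exp (-Real.pi * m * y⁻¹) ≤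
      decay y * (Real.exp (-(Real.pi / 2 * d * y)) * Real.exp (-(Real.pi / 2 * m * y⁻¹))) := by
    rw [decay, ← Real.exp_add, ← Real.exp_add, ← Real.exp_add, Real.exp_le_exp]
    have h1 : 0 ≤ Real.pi / 2 * y * (d - 1) := by
      have := sub_nonneg.2 hd1
      positivity
    have h2 : 0 ≤ Real.pi / 2 * y⁻¹ * (m - 1) := by
      have := sub_nonneg.2 hm1
      positivity
    linarith
  have e2 : Real.exp (-(Real.pi / 2 * d * y)) * Real.exp (-(Real.pi / 2 * m * y⁻¹)) ≤
      576 / ((d : ℝ) ^ 4 * (m : ℝ) ^ 4) := by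
    refine (mul_le_mul (exp_neg_le (by positivity)) (exp_neg_le (by positivity))
      (Real.exp_nonneg _) (by positivity)).trans ?_
    have h3 : 24 / (Real.pi / 2 * d * y) ^ 4 * (24 / (Real.pi / 2 * m * y⁻¹) ^ 4) =
        576 / ((d : ℝ) ^ 4 * (m : ℝ) ^ 4 * (Real.pi / 2) ^ 8) := by
      field_simp
      norm_num
    rw [h3]
    refine div_le_div_of_nonneg_left (by norm_num) (by positivity) ?_
    refine le_mul_of_one_le_right (by positivity) (one_le_pow₀ ?_)
    linarith
  have hdec : 0 ≤ decay y := Real.exp_nonneg _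
  have ha : (a d : ℝ) ≤ (d : ℝ) ^ 2 := by exact_mod_cast a_le_sq d
  have hb : (b m : ℝ) ≤ (m : ℝ) ^ 2 := by exact_mod_cast b_le_sq m
  rw [abs_of_nonneg (by positivity)]
  calc (a d : ℝ) * Real.exp (-Real.pi * d * y) * (b m * Real.exp (-Real.pi * m * y⁻¹))
      = (a d * b m) * (Real.exp (-Real.pi * d * y) * Real.exp (-Real.pi * m * y⁻¹)) := by ring
    _ ≤ ((d : ℝ) ^ 2 * (m : ℝ) ^ 2) * (decay y * (576 / ((d : ℝ) ^ 4 * (m : ℝ) ^ 4))) := by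
        refine mul_le_mul (mul_le_mul ha hb (Nat.cast_nonneg _) (by positivity))
          (e1.trans (mul_le_mul_of_nonneg_left e2 hdec)) (by positivity) (by positivity)
    _ = _ := by
        field_simp

theorem summable_one_div_sq_mul_one_div_sq :
    Summable fun p : ℕ × ℕ => 1 / (p.1 : ℝ) ^ 2 * (1 / (p.2 : ℝ) ^ 2) := by
  have h : Summable fun n : ℕ => 1 / (n : ℝ) ^ 2 := Real.summable_one_div_nat_pow.2 one_lt_two
  exact h.mul_of_nonneg h (fun n => by positivity) (fun n => by positivity)

theorem exists_abs_productSeries_le :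
    ∃ C : ℝ, ∀ y : ℝ, 0 < y → |productSeries y| ≤ C * decay y := by
  refine ⟨(∑' p : ℕ × ℕ, 1 / (p.1 : ℝ) ^ 2 * (1 / (p.2 : ℝ) ^ 2)) * 576, fun y hy => ?_⟩
  rw [← (hasSum_productTerm hy).tsum_eq, mul_assoc, ← tsum_mul_right, ← Real.norm_eq_abs]
  exact tsum_of_norm_bounded (summable_one_div_sq_mul_one_div_sq.mul_right _).hasSum
    (abs_productTerm_le hy)

theorem continuousOn_decay : ContinuousOn decay (Set.Ioi 0) := by
  have h : ContinuousOn (fun y : ℝ => y⁻¹) (Set.Ioi 0) :=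
    continuousOn_inv₀.mono fun y hy => (Set.mem_Ioi.1 hy).ne'
  unfold decay
  fun_prop

theorem continuousOn_productSeries : ContinuousOn productSeries (Set.Ioi 0) := by
  have h : ContinuousOn (fun y : ℝ => y⁻¹) (Set.Ioi 0) :=
    continuousOn_inv₀.mono fun y hy => (Set.mem_Ioi.1 hy).ne'
  exact (continuousOn_expSeries abs_a_le).mul
    ((continuousOn_expSeries abs_b_le).comp h fun y hy => Set.mem_Ioi.2 (inv_pos.2 hy))

theorem decay_isBigO_atTop (r : ℝ) : decay =O[atTop] fun x => x ^ r := by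
  refine IsBigO.trans ?_ (isLittleO_exp_neg_mul_rpow_atTop Real.pi_div_two_pos r).isBigO
  refine IsBigO.of_bound 1 ?_
  filter_upwards [eventually_gt_atTop 0] with y hy
  rw [decay, Real.norm_eq_abs, Real.norm_eq_abs, Real.abs_exp, Real.abs_exp, one_mul,
    Real.exp_le_exp]
  have : 0 ≤ Real.pi / 2 * y⁻¹ := by positivity
  linarith

theorem decay_inv (y : ℝ) : decay y⁻¹ = decay y := by
  rw [decay, decay, inv_inv, add_comm]

theorem decay_isBigO_nhdsGT_zero (r : ℝ) : decay =O[𝓝[>] 0] fun x => x ^ r := by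
  have h := (decay_isBigO_atTop (-r)).comp_tendsto tendsto_inv_nhdsGT_zero
  refine h.congr' (Eventually.of_forall decay_inv) ?_
  filter_upwards [self_mem_nhdsWithin] with y hy
  rw [Function.comp_apply, Real.inv_rpow (Set.mem_Ioi.1 hy).le, Real.rpow_neg (Set.mem_Ioi.1 hy).le,
    inv_inv]

theorem mellinConvergent_decay (s : ℂ) : MellinConvergent (fun y => (decay y : ℂ)) s := by
  refine mellinConvergent_of_isBigO_rpow (a := s.re + 1) (b := s.re - 1) ?_ ?_ (by linarith) ?_
    (by linarith)
  · exact (continuous_ofReal.comp_continuousOn continuousOn_decay).locallyIntegrableOn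
      measurableSet_Ioi
  · exact isBigO_ofReal_left.2 (decay_isBigO_atTop _)
  · exact isBigO_ofReal_left.2 (decay_isBigO_nhdsGT_zero _)

theorem productSeries_isBigO {l : Filter ℝ} (hl : ∀ᶠ y in l, 0 < y) :
    (fun y => (productSeries y : ℂ)) =O[l] decay := by
  obtain ⟨C, hC⟩ := exists_abs_productSeries_le
  refine isBigO_ofReal_left.2 (IsBigO.of_bound C ?_)
  filter_upwards [hl] with y hy
  rw [Real.norm_eq_abs, Real.norm_eq_abs, abs_of_nonneg (show 0 ≤ decay y from Real.exp_nonneg _)]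
  exact hC y hy

theorem locallyIntegrableOn_productSeries :
    LocallyIntegrableOn (fun y => (productSeries y : ℂ)) (Set.Ioi 0) :=
  (continuous_ofReal.comp_continuousOn continuousOn_productSeries).locallyIntegrableOn
    measurableSet_Ioi

theorem mellinConvergent_productSeries (s : ℂ) :
    MellinConvergent (fun y => (productSeries y : ℂ)) s := by
  refine mellinConvergent_of_isBigO_rpow (a := s.re + 1) (b := s.re - 1)
    locallyIntegrableOn_productSeries ?_ (by linarith) ?_ (by linarith)
  · exact (productSeries_isBigO (eventually_gt_atTop 0)).trans (decay_isBigO_atTop _)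
  · exact (productSeries_isBigO self_mem_nhdsWithin).trans (decay_isBigO_nhdsGT_zero _)

theorem differentiable_mellin_productSeries :
    Differentiable ℂ (mellin fun y => (productSeries y : ℂ)) := by
  intro s
  refine mellin_differentiableAt_of_isBigO_rpow (a := s.re + 1) (b := s.re - 1)
    locallyIntegrableOn_productSeries ?_ (by linarith) ?_ (by linarith)
  · exact (productSeries_isBigO (eventually_gt_atTop 0)).trans (decay_isBigO_atTop _)
  · exact (productSeries_isBigO self_mem_nhdsWithin).trans (decay_isBigO_nhdsGT_zero _)

end PrimePower

end

/-! ### Mellin transforms in terms of ζ, and vanishing at its nonreal zeros -/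

noncomputable section

namespace PrimePower

open Finset Filter Topology MeasureTheory Complex

open scoped ArithmeticFunction.sigma

theorem hasSum_sigma_div_cpow {w : ℂ} (hw : 2 < w.re) :
    HasSum (fun n : ℕ => (sigmaR n : ℂ) / (n : ℂ) ^ w) (riemannZeta w * riemannZeta (w - 1)) := by
  have h1 : LSeriesHasSum 1 w (riemannZeta w) := LSeriesHasSum_one (by linarith)
  have h2 : LSeriesHasSum (fun n : ℕ => (n : ℂ)) w (riemannZeta (w - 1)) := by
    have h : LSeriesHasSum 1 (w - 1) (riemannZeta (w - 1)) :=
      LSeriesHasSum_one (by rw [sub_re, one_re]; linarith)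
    refine HasSum.congr_fun h fun n => ?_
    rcases eq_or_ne n 0 with rfl | hn
    · simp
    · have hn' : (n : ℂ) ≠ 0 := Nat.cast_ne_zero.2 hn
      rw [LSeries.term_of_ne_zero hn, LSeries.term_of_ne_zero hn, cpow_sub _ _ hn', cpow_one,
        Pi.one_apply, one_div_div]
  refine HasSum.congr_fun (h1.convolution h2) fun n => ?_
  rcases eq_or_ne n 0 with rfl | hn
  · simp [sigmaR]
  · rw [LSeries.term_of_ne_zero hn, LSeries.convolution_def]
    congr 1
    rw [sigmaR, ArithmeticFunction.sigma_one_apply, ← Nat.sum_divisorsAntidiagonal' (fun _ d => d)]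
    simp

theorem hasSum_dilate_div_cpow {c : ℕ → ℝ} {w S : ℂ}
    (h : HasSum (fun n : ℕ => (c n : ℂ) / (n : ℂ) ^ w) S) {d : ℕ} (hd : 0 < d) :
    HasSum (fun n : ℕ => (dilate d c n : ℂ) / (n : ℂ) ^ w) ((d : ℂ) ^ (-w) * S) := by
  have hi : Function.Injective fun n : ℕ => d * n := fun m n h => Nat.eq_of_mul_eq_mul_left hd h
  rw [← hi.hasSum_iff]
  · refine (h.mul_left _).congr_fun fun n => ?_
    simp only [Function.comp_apply, dilate_mul hd]
    rw [Nat.cast_mul, natCast_mul_natCast_cpow, cpow_neg]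
    ring
  · intro n hn
    have : ¬ d ∣ n := fun ⟨m, hm⟩ => hn ⟨m, hm.symm⟩
    simp [dilate, this]

/-- The Euler factor at `2` of the Dirichlet series `∑ b(n) n ^ (-w)`, relative to that of
`ζ(w) ζ(w - 1)`. -/
def eulerFactor (w : ℂ) : ℂ := 1 - 3 * (2 : ℂ) ^ (-w) + 2 * (4 : ℂ) ^ (-w)

theorem hasSum_b_div_cpow {w : ℂ} (hw : 2 < w.re) :
    HasSum (fun n : ℕ => (b n : ℂ) / (n : ℂ) ^ w)
      (eulerFactor w * (riemannZeta w * riemannZeta (w - 1))) := by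
  have h := hasSum_sigma_div_cpow hw
  have h2 := hasSum_dilate_div_cpow h two_pos
  have h4 := hasSum_dilate_div_cpow h four_pos
  have key := (h.sub (h2.mul_left 3)).add (h4.mul_left 2)
  rw [eulerFactor, add_mul, sub_mul, one_mul, mul_assoc, mul_assoc]
  refine key.congr_fun fun n => ?_
  have : (b n : ℂ) = sigmaR n - 3 * dilate 2 sigmaR n + 2 * dilate 4 sigmaR n := by
    exact_mod_cast congrArg ((↑) : ℝ → ℂ) (b_eq_sigmaR_sub n)
  rw [this]
  ring

theorem summable_norm_b_div_rpow {w : ℂ} (hw : 2 < w.re) :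
    Summable fun n : ℕ => ‖(b n : ℂ)‖ / (n : ℝ) ^ w.re := by
  refine (hasSum_b_div_cpow hw).summable.norm.congr fun n => ?_
  rcases Nat.eq_zero_or_pos n with rfl | hn
  · simp [b]
  · rw [norm_div, norm_natCast_cpow_of_pos hn]

theorem hasSum_mellin_seriesB {w : ℂ} (hw : 2 < w.re) :
    HasSum (fun n : ℕ => (Real.pi : ℂ) ^ (-w) * Gamma w * b n / (n : ℂ) ^ w)
      (mellin (fun x => (seriesB x : ℂ)) w) := by
  refine hasSum_mellin_pi_mul (q := fun n : ℕ => (n : ℝ)) (fun n => ?_) (by linarith) ?_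
    (summable_norm_b_div_rpow hw)
  · rcases Nat.eq_zero_or_pos n with rfl | hn
    · simp [b]
    · exact Or.inr (Nat.cast_pos.2 hn)
  · intro x hx
    exact_mod_cast hasSum_ofReal.2 (hasSum_expSeries abs_b_le (Set.mem_Ioi.1 hx))

theorem mellin_seriesB {w : ℂ} (hw : 2 < w.re) :
    mellin (fun x => (seriesB x : ℂ)) w = (Real.pi : ℂ) ^ (-w) * Gamma w *
      (eulerFactor w * (riemannZeta w * riemannZeta (w - 1))) := by
  refine (hasSum_mellin_seriesB hw).unique
    (((hasSum_b_div_cpow hw).mul_left _).congr_fun fun n => ?_)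
  ring

/-- Termwise, the extra factor n cancels against n^(w+1), and Γ(w + 1) = w Γ(w) supplies w. -/
theorem mellin_seriesNB {w : ℂ} (hw : 2 < w.re) :
    mellin (fun x => (seriesNB x : ℂ)) (w + 1) =
      w / Real.pi * mellin (fun x => (seriesB x : ℂ)) w := by
  have hw0 : w ≠ 0 := by
    rintro rfl
    simp at hw
    linarith
  have hpi : (Real.pi : ℂ) ≠ 0 := ofReal_ne_zero.2 Real.pi_ne_zero
  have h : HasSum (fun n : ℕ => (Real.pi : ℂ) ^ (-(w + 1)) * Gamma (w + 1) * (n * b n : ℂ) /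
      (n : ℂ) ^ (w + 1)) (mellin (fun x => (seriesNB x : ℂ)) (w + 1)) := by
    refine hasSum_mellin_pi_mul (q := fun n : ℕ => (n : ℝ)) (fun n => ?_)
      (by rw [add_re, one_re]; linarith) ?_ ((summable_norm_b_div_rpow hw).congr fun n => ?_)
    · rcases Nat.eq_zero_or_pos n with rfl | hn
      · simp
      · exact Or.inr (Nat.cast_pos.2 hn)
    · intro x hx
      refine (hasSum_ofReal.2 (hasSum_expSeries abs_nat_mul_b_le (Set.mem_Ioi.1 hx))).congr_fun
        fun n => ?_
      push_cast
      rfl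
    · rcases Nat.eq_zero_or_pos n with rfl | hn
      · simp [b]
      · have hn' : (0 : ℝ) < n := Nat.cast_pos.2 hn
        rw [add_re, one_re, Real.rpow_add_one hn'.ne', norm_mul, Complex.norm_natCast n,
          mul_comm (n : ℝ), mul_div_mul_right _ _ hn'.ne']
  refine h.unique (((hasSum_mellin_seriesB hw).mul_left _).congr_fun fun n => ?_)
  rcases Nat.eq_zero_or_pos n with rfl | hn
  · simp [b]
  · have hn' : (n : ℂ) ≠ 0 := Nat.cast_ne_zero.2 hn.ne'
    rw [Gamma_add_one w hw0, neg_add, cpow_add _ _ hpi, cpow_add _ _ hn', cpow_one, cpow_neg_one]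
    have : (n : ℂ) ^ w ≠ 0 := by simp [cpow_eq_zero_iff, hn']
    field_simp

/-- Use e^(-nx) ≤ N!/(nx)^N with N = (j + 1) + 2 + i: the first part of N beats the coefficient, 2
gives a convergent sum, and i is free, to be 0 near the origin and large at infinity. -/
theorem exists_abs_expSeries_le {c : ℕ → ℝ} {j : ℕ} (hc : ∀ n, |c n| ≤ (n : ℝ) ^ (j + 1)) (i : ℕ) :
    ∃ C : ℝ, ∀ x : ℝ, 0 < x → |expSeries c x| ≤ C * x ^ (-(j + 3 + i : ℝ)) := by
  refine ⟨∑' n : ℕ, 1 / (n : ℝ) ^ 2 * (j + 3 + i).factorial, fun x hx => ?_⟩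
  have hs : Summable fun n : ℕ => 1 / (n : ℝ) ^ 2 := Real.summable_one_div_nat_pow.2 one_lt_two
  rw [← tsum_mul_right, ← Real.norm_eq_abs]
  refine tsum_of_norm_bounded ((hs.mul_right _).mul_right _).hasSum fun n => ?_
  rcases Nat.eq_zero_or_pos n with rfl | hn
  · have h0 : c 0 = 0 := by simpa using hc 0
    simp [h0]
  have hn1 : (1 : ℝ) ≤ n := by exact_mod_cast hn
  have hpi : (1 : ℝ) ≤ Real.pi := by linarith [Real.two_le_pi]
  have he : Real.exp (-Real.pi * n * x) ≤ (j + 3 + i).factorial / (n * x) ^ (j + 3 + i) := by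
    have h1 : Real.exp (-Real.pi * n * x) ≤ Real.exp (-(n * x)) := by
      rw [Real.exp_le_exp]
      have : 0 ≤ (Real.pi - 1) * (n * x) := mul_nonneg (by linarith) (by positivity)
      linarith
    refine h1.trans ?_
    rw [Real.exp_neg, ← inv_div]
    exact inv_anti₀ (by positivity) (Real.pow_div_factorial_le_exp _ (by positivity) _)
  rw [norm_mul, Real.norm_eq_abs, Real.norm_eq_abs, Real.abs_exp]
  refine (mul_le_mul (hc n) he (Real.exp_nonneg _) (by positivity)).trans ?_
  rw [show -(j + 3 + i : ℝ) = -((j + 3 + i : ℕ) : ℝ) by push_cast; ring, Real.rpow_neg hx.le,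
    Real.rpow_natCast]
  have h2 : (n : ℝ) ^ (j + 1) * ((j + 3 + i).factorial / (n * x) ^ (j + 3 + i)) =
      1 / (n : ℝ) ^ 2 * (j + 3 + i).factorial * (x ^ (j + 3 + i))⁻¹ / (n : ℝ) ^ i := by
    rw [show j + 3 + i = (j + 1) + 2 + i by ring, mul_pow, pow_add (n : ℝ), pow_add (n : ℝ)]
    field_simp
    ring
  rw [h2]
  exact div_le_self (by positivity) (one_le_pow₀ hn1)

theorem mellinConvergent_expSeries {c : ℕ → ℝ} {j : ℕ} (hc : ∀ n, |c n| ≤ (n : ℝ) ^ (j + 1))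
    {w : ℂ} (hw : j + 3 < w.re) : MellinConvergent (fun x => (expSeries c x : ℂ)) w := by
  have hO : ∀ (i : ℕ) {l : Filter ℝ}, (∀ᶠ x in l, 0 < x) →
      (fun x => (expSeries c x : ℂ)) =O[l] fun x => x ^ (-(j + 3 + i : ℝ)) := by
    intro i l hl
    obtain ⟨C, hC⟩ := exists_abs_expSeries_le hc i
    refine isBigO_ofReal_left.2 (Asymptotics.IsBigO.of_bound C ?_)
    filter_upwards [hl] with x hx
    rw [Real.norm_eq_abs, Real.norm_eq_abs, abs_of_nonneg (Real.rpow_nonneg hx.le _)]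
    exact hC x hx
  obtain ⟨i, hi⟩ := exists_nat_gt w.re
  refine mellinConvergent_of_isBigO_rpow (a := j + 3 + i) (b := j + 3) ?_
    (hO i (eventually_gt_atTop 0)) (by have : (0 : ℝ) ≤ j := j.cast_nonneg; linarith) ?_ hw
  · exact (continuous_ofReal.comp_continuousOn (continuousOn_expSeries hc)).locallyIntegrableOn
      measurableSet_Ioi
  · simpa using hO 0 (l := 𝓝[>] 0) self_mem_nhdsWithin

/-- Replace y by 1/x and use `seriesA_inv_mul_seriesB`. The coefficient is (1 - s)/(8π) - 1/(4π) =
-(s + 1)/(8π). The bound on Re s puts 2 - s in the half-plane Re w > 5 where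
`mellinConvergent_expSeries` applies to coefficients bounded by n³. -/
theorem mellin_productSeries_of_re_lt {s : ℂ} (hs : s.re < -3) :
    mellin (fun y => (productSeries y : ℂ)) s =
      -(s + 1) / (8 * Real.pi) * mellin (fun x => (seriesB x : ℂ)) (1 - s) := by
  have hw : 4 < (1 - s).re := by
    rw [sub_re, one_re]
    linarith
  have hB : MellinConvergent (fun x => (seriesB x : ℂ)) (-s + 1) :=
    mellinConvergent_expSeries (j := 1) abs_b_le (by rw [neg_add_eq_sub]; norm_num; linarith)
  have hN : MellinConvergent (fun x => (seriesNB x : ℂ)) (-s + 2) :=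
    mellinConvergent_expSeries (j := 2) abs_nat_mul_b_le (by norm_num; linarith)
  have hB' := MellinConvergent.cpow_smul.2 hB
  have hN' := MellinConvergent.cpow_smul.2 hN
  have key := (hasMellin_sub (hN'.const_smul (1 / 8 : ℂ)) (hB'.const_smul (1 / (4 * Real.pi) : ℂ))).2
  rw [mellin_const_smul, mellin_const_smul, mellin_cpow_smul, mellin_cpow_smul,
    show -s + 2 = (1 - s) + 1 by ring, mellin_seriesNB (by linarith), neg_add_eq_sub] at key
  have hinv := mellin_comp_inv (fun y => (productSeries y : ℂ)) (-s)
  rw [neg_neg] at hinv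
  rw [← hinv]
  have hcongr : mellin (fun x => (productSeries x⁻¹ : ℂ)) (-s) =
      mellin (fun t : ℝ => (1 / 8 : ℂ) • ((t : ℂ) ^ (2 : ℂ) • (seriesNB t : ℂ)) -
        (1 / (4 * Real.pi) : ℂ) • ((t : ℂ) ^ (1 : ℂ) • (seriesB t : ℂ))) (-s) := by
    refine setIntegral_congr_fun measurableSet_Ioi fun x hx => ?_
    have h := seriesA_inv_mul_seriesB (Set.mem_Ioi.1 hx)
    simp only [productSeries, inv_inv]
    rw [h]
    congr 1
    simp only [smul_eq_mul, cpow_one, cpow_ofNat]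
    push_cast
    ring
  rw [hcongr, key]
  have hpi : (Real.pi : ℂ) ≠ 0 := ofReal_ne_zero.2 Real.pi_ne_zero
  simp only [smul_eq_mul]
  field_simp
  ring

/-- The Mellin transform of `A(y) B(1 / y)` in terms of the Riemann zeta function. -/
theorem mellin_productSeries_div_Gamma {s : ℂ} (h0 : s ≠ 0) (h1 : s ≠ -1) :
    mellin (fun y => (productSeries y : ℂ)) s * (Gamma (1 - s))⁻¹ =
      -(s + 1) / (8 * Real.pi) * (Real.pi : ℂ) ^ (-(1 - s)) *
        (eulerFactor (1 - s) * (riemannZeta (1 - s) * riemannZeta (-s))) := by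
  have hpi : (Real.pi : ℂ) ≠ 0 := ofReal_ne_zero.2 Real.pi_ne_zero
  -- Dividing by Γ(1 - s) keeps the left side entire. The excluded points are the poles of ζ(1 - s)
  -- and ζ(-s); their complement is connected, so agreement near -4 suffices.
  let U : Set ℂ := {0, -1}ᶜ
  have hfin : ({0, -1} : Set ℂ).Finite := by simp
  have hU : IsOpen U := hfin.isClosed.isOpen_compl
  have hconn : IsPreconnected U :=
    (hfin.countable.isPathConnected_compl_of_one_lt_rank
      (by rw [rank_real_complex]; norm_num)).isConnected.isPreconnected
  have hz : ∀ t ∈ U, t ≠ 0 ∧ t ≠ -1 := fun t ht => by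
    simpa [U, not_or] using ht
  have hf : AnalyticOnNhd ℂ (fun s => mellin (fun y => (productSeries y : ℂ)) s *
      (Gamma (1 - s))⁻¹) U := by
    refine DifferentiableOn.analyticOnNhd (fun t _ => ?_) hU
    refine ((differentiable_mellin_productSeries t).mul ?_).differentiableWithinAt
    exact (differentiable_one_div_Gamma (1 - t)).comp t (by fun_prop)
  have hg : AnalyticOnNhd ℂ (fun s => -(s + 1) / (8 * Real.pi) * (Real.pi : ℂ) ^ (-(1 - s)) *
        (eulerFactor (1 - s) * (riemannZeta (1 - s) * riemannZeta (-s)))) U := by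
    refine DifferentiableOn.analyticOnNhd (fun t ht => ?_) hU
    obtain ⟨ht0, ht1⟩ := hz t ht
    have d1 : DifferentiableAt ℂ (fun s => riemannZeta (1 - s)) t :=
      (differentiableAt_riemannZeta (by simpa [sub_eq_self] using ht0)).comp t (by fun_prop)
    have d2 : DifferentiableAt ℂ (fun s => riemannZeta (-s)) t :=
      (differentiableAt_riemannZeta (by
        intro h
        exact ht1 (by rw [← h, neg_neg]))).comp t (by fun_prop)
    have d3 : ∀ c : ℂ, c ≠ 0 → DifferentiableAt ℂ (fun s : ℂ => c ^ (-(1 - s))) t := fun c hc =>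
      DifferentiableAt.const_cpow (by fun_prop) (Or.inl hc)
    have d4 : DifferentiableAt ℂ (fun s => eulerFactor (1 - s)) t := by
      unfold eulerFactor
      exact ((differentiableAt_const _).sub ((d3 2 (by norm_num)).const_mul 3)).add
        ((d3 4 (by norm_num)).const_mul 2)
    have d5 : DifferentiableAt ℂ (fun s : ℂ => -(s + 1) / (8 * Real.pi)) t := by fun_prop
    exact ((d5.mul (d3 _ hpi)).mul (d4.mul (d1.mul d2))).differentiableWithinAt
  have hev : (fun s => mellin (fun y => (productSeries y : ℂ)) s * (Gamma (1 - s))⁻¹) =ᶠ[𝓝 (-4)]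
      fun s => -(s + 1) / (8 * Real.pi) * (Real.pi : ℂ) ^ (-(1 - s)) *
        (eulerFactor (1 - s) * (riemannZeta (1 - s) * riemannZeta (-s))) := by
    have ho : IsOpen {t : ℂ | t.re < -3} := isOpen_lt continuous_re continuous_const
    filter_upwards [ho.mem_nhds (show (-4 : ℂ) ∈ {t : ℂ | t.re < -3} by norm_num)] with t ht
    have hre : 2 < (1 - t).re := by
      rw [sub_re, one_re]
      have : t.re < -3 := ht
      linarith
    have hG : Gamma (1 - t) ≠ 0 := Gamma_ne_zero_of_re_pos (by linarith)
    rw [mellin_productSeries_of_re_lt ht, mellin_seriesB hre, show 1 - t - 1 = -t by ring]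
    field_simp
  exact hf.eqOn_of_preconnected_of_eventuallyEq hg hconn
    (show (-4 : ℂ) ∈ U by simp [U]) hev (show s ∈ U by simp [U, h0, h1])

theorem mellin_productSeries_eq_zero {s : ℂ} (hs : riemannZeta s = 0) (him : s.im ≠ 0) :
    mellin (fun y => (productSeries y : ℂ)) s = 0 := by
  have hne : ∀ r : ℝ, s ≠ r := fun r h => him (by rw [h, ofReal_im])
  -- Being nonreal, s avoids the exceptional points of the functional equation, the poles of Γ(1 -
  -- s), and the points 0 and -1.
  have hζ : riemannZeta (1 - s) = 0 := by
    rw [riemannZeta_one_sub (fun n => by exact_mod_cast hne (-n)) (by exact_mod_cast hne 1), hs,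
      mul_zero]
  have hG : Gamma (1 - s) ≠ 0 := by
    refine Gamma_ne_zero fun n h => hne (1 + n) ?_
    push_cast
    linear_combination -h
  have h := mellin_productSeries_div_Gamma (by exact_mod_cast hne 0) (by exact_mod_cast hne (-1))
  rw [hζ, zero_mul, mul_zero, mul_zero] at h
  exact (mul_eq_zero.1 h).resolve_right (inv_ne_zero hG)

end PrimePower

end

/-! ### From the Mellin transform back to G and its Bessel series -/

noncomputable section

namespace PrimePower

open Finset Filter Topology MeasureTheory Complex

/-- Regroups a sum over pairs (d, m) by the product j = dm. -/
theorem hasSum_sum_divisors {E : Type*} [AddCommGroup E] [TopologicalSpace E]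
    [IsTopologicalAddGroup E] {T : ℕ × ℕ → E} {S : E} (h : HasSum T S)
    (h0 : ∀ p : ℕ × ℕ, p.1 = 0 ∨ p.2 = 0 → T p = 0) :
    HasSum (fun j : ℕ+ => ∑ d ∈ (j : ℕ).divisors, T (d, j / d)) S := by
  have h1 : HasSum (fun p : ℕ+ × ℕ+ => T (p.1, p.2)) S := by
    have hi : Function.Injective fun p : ℕ+ × ℕ+ => ((p.1 : ℕ), (p.2 : ℕ)) := by
      rintro ⟨a, b⟩ ⟨c, d⟩ h
      simpa using h
    refine (hi.hasSum_iff ?_).2 h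
    rintro ⟨d, m⟩ hp
    refine h0 _ ?_
    by_contra! hne
    exact hp ⟨(⟨d, Nat.pos_of_ne_zero hne.1⟩, ⟨m, Nat.pos_of_ne_zero hne.2⟩), rfl⟩
  rw [← sigmaAntidiagonalEquivProd.hasSum_iff] at h1
  refine (h1.sigma fun j => hasSum_fintype _).congr_fun fun j => ?_
  rw [← Nat.sum_divisorsAntidiagonal (fun d m => T (d, m)), ← sum_coe_sort]
  rfl

theorem image_exp_univ : Real.exp '' Set.univ = Set.Ioi 0 := by
  rw [Set.image_univ, Real.range_exp]

theorem exp_smul_cpow_smul (f : ℝ → ℝ) (s : ℂ) (v : ℝ) :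
    |Real.exp v| • (((Real.exp v : ℝ) : ℂ) ^ (s - 1) • (f (Real.exp v) : ℂ)) =
      cexp (s * v) * f (Real.exp v) := by
  have h : ((Real.exp v : ℝ) : ℂ) ≠ 0 := ofReal_ne_zero.2 (Real.exp_ne_zero v)
  rw [Real.abs_exp, real_smul, smul_eq_mul, ← mul_assoc, cpow_sub _ _ h, cpow_one,
    mul_div_cancel₀ _ h, cpow_def_of_ne_zero h, ← ofReal_log (Real.exp_nonneg v), Real.log_exp,
    mul_comm s]

theorem mellin_eq_integral_exp (f : ℝ → ℝ) (s : ℂ) :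
    mellin (fun y => (f y : ℂ)) s = ∫ v : ℝ, cexp (s * v) * f (Real.exp v) := by
  rw [mellin, ← image_exp_univ, integral_image_eq_integral_abs_deriv_smul MeasurableSet.univ
    (fun x _ => (Real.hasDerivAt_exp x).hasDerivWithinAt) Real.exp_injective.injOn,
    Measure.restrict_univ]
  exact integral_congr_ae (Eventually.of_forall fun v => exp_smul_cpow_smul f s v)

theorem mellinConvergent_iff_integrable_exp (f : ℝ → ℝ) (s : ℂ) :
    MellinConvergent (fun y => (f y : ℂ)) s ↔
      Integrable fun v : ℝ => cexp (s * v) * f (Real.exp v) := by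
  rw [MellinConvergent, ← image_exp_univ,
    integrableOn_image_iff_integrableOn_abs_deriv_smul MeasurableSet.univ
    (fun x _ => (Real.hasDerivAt_exp x).hasDerivWithinAt) Real.exp_injective.injOn,
    integrableOn_univ]
  exact integrable_congr (Eventually.of_forall fun v => exp_smul_cpow_smul f s v)

theorem exp_shift_sq {d m : ℕ} (hd : 0 < d) (hm : 0 < m) :
    (d : ℝ) * Real.exp (shift d (d * m)) ^ 2 = m := by
  have hd' : (0 : ℝ) < d := Nat.cast_pos.2 hd
  have hm' : (0 : ℝ) < m := Nat.cast_pos.2 hm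
  rw [← Real.exp_nat_mul, shift, Nat.cast_mul, Nat.cast_ofNat,
    show (2 : ℝ) * (1 / 2 * Real.log (d * m / (d : ℝ) ^ 2)) = Real.log (d * m / (d : ℝ) ^ 2) by ring,
    Real.exp_log (by positivity)]
  field_simp

theorem sqrt_mul_eq_mul_exp_shift {d m : ℕ} (hd : 0 < d) (hm : 0 < m) :
    √((d * m : ℕ) : ℝ) = d * Real.exp (shift d (d * m)) := by
  rw [Real.sqrt_eq_iff_mul_self_eq (by positivity) (by positivity), Nat.cast_mul,
    ← exp_shift_sq hd hm]
  ring

/-- With j = dm one has √j = d e^T and d e^(2T) = m, so the shift turns the symmetric exponent into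
-π(d e^v + m e^(-v)), while (j/d²)^(1/4) = e^(T/2) cancels the shift in e^((v - T)/2). -/
theorem summand_termG (v : ℝ) {d j : ℕ} (hj : 0 < j) (hd : d ∈ j.divisors) :
    (a d : ℝ) * (b (j / d) : ℝ) * ((j : ℝ) / (d : ℝ) ^ 2) ^ (1 / 4 : ℝ) *
      g (v - shift d j) (2 * Real.pi * √(j : ℝ)) =
    Real.exp (v / 2) * productTerm (Real.exp v) (d, j / d) := by
  obtain ⟨m, rfl⟩ := Nat.dvd_of_mem_divisors hd
  have hd0 : 0 < d := Nat.pos_of_mul_pos_right hj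
  have hm0 : 0 < m := Nat.pos_of_mul_pos_left hj
  have hd' : (0 : ℝ) < d := Nat.cast_pos.2 hd0
  have hm' : (0 : ℝ) < m := Nat.cast_pos.2 hm0
  have h2 := exp_shift_sq hd0 hm0
  have hroot : (((d * m : ℕ) : ℝ) / (d : ℝ) ^ 2) ^ (1 / 4 : ℝ) =
      Real.exp (shift d (d * m) / 2) := by
    rw [Real.rpow_def_of_pos (by positivity), shift]
    congr 1
    ring
  rw [Nat.mul_div_cancel_left _ hd0, hroot, sqrt_mul_eq_mul_exp_shift hd0 hm0, g, productTerm]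
  dsimp only
  rw [← Real.exp_neg]
  set T := shift d (d * m)
  have e1 : Real.exp T * Real.exp (v - T) = Real.exp v := by
    rw [← Real.exp_add]
    congr 1
    ring
  have e2 : Real.exp T * Real.exp (-(v - T)) = Real.exp T ^ 2 * Real.exp (-v) := by
    rw [sq, ← Real.exp_add, ← Real.exp_add, ← Real.exp_add]
    congr 1
    ring
  have e3 : -(2 * Real.pi * (d * Real.exp T) / 2) * (Real.exp (v - T) + Real.exp (-(v - T))) =
      -Real.pi * d * Real.exp v + -Real.pi * m * Real.exp (-v) := by
    rw [← h2, ← e1]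
    linear_combination (-Real.pi * d) * e2
  have e4 : Real.exp (v / 2) = Real.exp (T / 2) * Real.exp ((v - T) / 2) := by
    rw [← Real.exp_add]
    congr 1
    ring
  rw [e3, e4, Real.exp_add]
  ring

theorem hasSum_termG (v : ℝ) :
    HasSum (termG v) (Real.exp (v / 2) * productSeries (Real.exp v)) := by
  have h := hasSum_sum_divisors ((hasSum_productTerm (Real.exp_pos v)).mul_left (Real.exp (v / 2)))
    (by
      rintro ⟨d, m⟩ (rfl | rfl)
      · simp [productTerm, a]
      · simp [productTerm, b])
  exact h.congr_fun fun j => sum_congr rfl fun d hd => summand_termG v j.pos hd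

theorem G_eq (v : ℝ) : G v = Real.exp (v / 2) * productSeries (Real.exp v) :=
  (hasSum_termG v).tsum_eq

theorem exp_mul_G (t : ℂ) (v : ℝ) : cexp (I * t * v) * (G v : ℂ) =
    cexp ((1 / 2 + I * t) * v) * productSeries (Real.exp v) := by
  rw [G_eq, ofReal_mul, ofReal_exp, ← mul_assoc, ← Complex.exp_add]
  congr 2
  push_cast
  ring

theorem fourierTransform_G (t : ℂ) :
    fourierTransform G t = mellin (fun y => (productSeries y : ℂ)) (1 / 2 + I * t) := by
  rw [mellin_eq_integral_exp, fourierTransform]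
  simp_rw [exp_mul_G]

theorem integrable_exp_mul_G (t : ℂ) :
    Integrable fun v : ℝ => cexp (I * t * v) * (G v : ℂ) := by
  simp_rw [exp_mul_G]
  exact (mellinConvergent_iff_integrable_exp _ _).1 (mellinConvergent_productSeries _)

/-- The substitution u = e^(-T) y makes dy + m/y proportional to u + 1/u, and its Jacobian factor
e^(Ts) is (j/d²)^(s/2). -/
theorem mellin_exp_eq_besselK (s : ℂ) {d m : ℕ} (hd : 0 < d) (hm : 0 < m) :
    mellin (fun y => ((Real.exp (-Real.pi * d * y) * Real.exp (-Real.pi * m * y⁻¹) : ℝ) : ℂ)) s =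
      (((d * m : ℕ) : ℂ) / (d : ℂ) ^ 2) ^ (s / 2) *
        (2 * besselK s (2 * Real.pi * √((d * m : ℕ) : ℝ))) := by
  have hd' : (0 : ℝ) < d := Nat.cast_pos.2 hd
  have hm' : (0 : ℝ) < m := Nat.cast_pos.2 hm
  have h2 := exp_shift_sq hd hm
  rw [sqrt_mul_eq_mul_exp_shift hd hm]
  have hT : ((d * m : ℕ) : ℝ) / (d : ℝ) ^ 2 = Real.exp (2 * shift d (d * m)) := by
    rw [shift, ← mul_assoc, mul_one_div_cancel two_ne_zero, one_mul, Real.exp_log (by positivity)]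
  have hTc : ((d * m : ℕ) : ℂ) / (d : ℂ) ^ 2 = ((Real.exp (2 * shift d (d * m)) : ℝ) : ℂ) := by
    rw [← hT]
    push_cast
    rfl
  rw [hTc]
  set T := shift d (d * m)
  have hT0 : 0 < Real.exp (-T) := Real.exp_pos _
  have hcomp := mellin_comp_mul_left (fun u : ℝ =>
    ((Real.exp (-(2 * Real.pi * (d * Real.exp T) / 2) * (u + 1 / u)) : ℝ) : ℂ)) s hT0
  have hbessel : 2 * besselK s (2 * Real.pi * (d * Real.exp T)) = mellin (fun u : ℝ =>
      ((Real.exp (-(2 * Real.pi * (d * Real.exp T) / 2) * (u + 1 / u)) : ℝ) : ℂ)) s := by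
    rw [besselK, ← mul_assoc, mul_one_div_cancel two_ne_zero, one_mul]
    rfl
  have hpow : ((Real.exp (-T) : ℝ) : ℂ) ^ (-s) = ((Real.exp (2 * T) : ℝ) : ℂ) ^ (s / 2) := by
    rw [cpow_def_of_ne_zero (ofReal_ne_zero.2 (Real.exp_ne_zero _)),
      cpow_def_of_ne_zero (ofReal_ne_zero.2 (Real.exp_ne_zero _)),
      ← ofReal_log (Real.exp_nonneg _), ← ofReal_log (Real.exp_nonneg _), Real.log_exp,
      Real.log_exp]
    congr 1
    push_cast
    ring
  rw [smul_eq_mul] at hcomp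
  rw [hbessel, ← hpow, ← hcomp]
  refine setIntegral_congr_fun measurableSet_Ioi fun y hy => ?_
  have hy0 : y ≠ 0 := (Set.mem_Ioi.1 hy).ne'
  dsimp only
  congr 2
  rw [← Real.exp_add, ← h2, Real.exp_neg]
  congr 1
  have := Real.exp_ne_zero T
  field_simp
  ring

/-- Sum and integral may be exchanged for every s, since `abs_productTerm_le` separates a summable
factor from the integrable function |y^(s-1)| `decay y`. -/
theorem hasSum_mellin_productTerm (s : ℂ) :
    HasSum (fun p => mellin (fun y => (productTerm y p : ℂ)) s)
      (mellin (fun y => (productSeries y : ℂ)) s) := by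
  have hdec : IntegrableOn (fun y : ℝ => (y : ℂ) ^ (s - 1) • (decay y : ℂ)) (Set.Ioi 0) :=
    mellinConvergent_decay s
  have hbound : ∀ p : ℕ × ℕ, ∀ y ∈ Set.Ioi (0 : ℝ), ‖(y : ℂ) ^ (s - 1) • (productTerm y p : ℂ)‖ ≤
      1 / (p.1 : ℝ) ^ 2 * (1 / (p.2 : ℝ) ^ 2) *
        (576 * ‖(y : ℂ) ^ (s - 1) • (decay y : ℂ)‖) := by
    intro p y hy
    have h := mul_le_mul_of_nonneg_left (abs_productTerm_le (Set.mem_Ioi.1 hy) p)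
      (norm_nonneg ((y : ℂ) ^ (s - 1)))
    rw [norm_smul, norm_smul, norm_real, norm_real, Real.norm_eq_abs, Real.norm_eq_abs,
      abs_of_nonneg (show 0 ≤ decay y from Real.exp_nonneg _)]
    refine h.trans (le_of_eq ?_)
    ring
  have hcont : ∀ p : ℕ × ℕ,
      ContinuousOn (fun y : ℝ => (y : ℂ) ^ (s - 1) • (productTerm y p : ℂ)) (Set.Ioi 0) := by
    intro p
    have hi : ContinuousOn (fun y : ℝ => y⁻¹) (Set.Ioi 0) :=
      continuousOn_inv₀.mono fun y hy => (Set.mem_Ioi.1 hy).ne'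
    have hp : ContinuousOn (fun y : ℝ => productTerm y p) (Set.Ioi 0) := by
      unfold productTerm
      fun_prop
    refine ContinuousOn.fun_mul (fun y hy => ?_) (continuous_ofReal.comp_continuousOn hp)
    exact (continuousAt_ofReal_cpow_const y (s - 1)
      (Or.inr (Set.mem_Ioi.1 hy).ne')).continuousWithinAt
  have hint : ∀ p : ℕ × ℕ,
      IntegrableOn (fun y : ℝ => (y : ℂ) ^ (s - 1) • (productTerm y p : ℂ)) (Set.Ioi 0) := by
    intro p
    refine Integrable.mono' ((hdec.norm.const_mul 576).const_mul
      (1 / (p.1 : ℝ) ^ 2 * (1 / (p.2 : ℝ) ^ 2)))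
      ((hcont p).aestronglyMeasurable measurableSet_Ioi) ?_
    exact (ae_restrict_iff' measurableSet_Ioi).2 (Eventually.of_forall (hbound p))
  have key := hasSum_integral_of_summable_integral_norm hint ?_
  · have hsum : mellin (fun y => (productSeries y : ℂ)) s =
        ∫ y in Set.Ioi (0 : ℝ), ∑' p : ℕ × ℕ, (y : ℂ) ^ (s - 1) • (productTerm y p : ℂ) := by
      refine setIntegral_congr_fun measurableSet_Ioi fun y hy => ?_
      exact (((hasSum_ofReal.2 (hasSum_productTerm (Set.mem_Ioi.1 hy))).const_smul _).tsum_eq).symm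
    rw [hsum]
    exact key
  · refine Summable.of_nonneg_of_le (fun p => integral_nonneg fun y => norm_nonneg _) (fun p => ?_)
      (summable_one_div_sq_mul_one_div_sq.mul_right
        (576 * ∫ y in Set.Ioi (0 : ℝ), ‖(y : ℂ) ^ (s - 1) • (decay y : ℂ)‖))
    rw [← integral_const_mul, ← integral_const_mul]
    exact setIntegral_mono_on (hint p).norm ((hdec.norm.const_mul 576).const_mul _)
      measurableSet_Ioi (hbound p)

theorem hasSum_termGHat (t : ℂ) : HasSum (termGHat t) (fourierTransform G t) := by
  rw [fourierTransform_G]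
  have h := hasSum_sum_divisors (hasSum_mellin_productTerm (1 / 2 + I * t)) (by
      rintro ⟨d, m⟩ (rfl | rfl)
      · simp [productTerm, a, mellin]
      · simp [productTerm, b, mellin])
  refine h.congr_fun fun j => sum_congr rfl fun d hd => ?_
  obtain ⟨m, hm⟩ := Nat.dvd_of_mem_divisors hd
  have hj := j.pos
  rw [hm] at hj ⊢
  have hd0 : 0 < d := Nat.pos_of_mul_pos_right hj
  have hm0 : 0 < m := Nat.pos_of_mul_pos_left hj
  rw [Nat.mul_div_cancel_left _ hd0, mul_assoc, ← mellin_exp_eq_besselK _ hd0 hm0, ← smul_eq_mul,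
    ← mellin_const_smul]
  congr 1
  ext y
  simp only [productTerm, smul_eq_mul]
  push_cast
  ring

theorem fourierTransform_G_eq_zero {γ : ℂ} (hγ : γ ∈ zetaOrdinates) :
    fourierTransform G γ = 0 := by
  rw [fourierTransform_G]
  exact mellin_productSeries_eq_zero hγ.1 hγ.2

end PrimePower

end

theorem theorem1 :
    -- the series defining `G` converges absolutely, and `e^(itv) G(v)` is integrable
    (∀ v : ℝ, Summable (PrimePower.termG v)) ∧
    (∀ t : ℂ, MeasureTheory.Integrable
      (fun v : ℝ => Complex.exp (Complex.I * t * (v : ℂ)) * (PrimePower.G v : ℂ))) ∧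
    -- the Fourier transform of `G` as a series of Bessel functions
    (∀ t : ℂ, HasSum (PrimePower.termGHat t) (PrimePower.fourierTransform PrimePower.G t)) ∧
    -- it vanishes at every `γ`
    (∀ γ ∈ PrimePower.zetaOrdinates, PrimePower.fourierTransform PrimePower.G γ = 0) ∧
    -- the sum over the zeros, without and with multiplicity
    HasSum (fun γ : PrimePower.zetaOrdinates =>
      PrimePower.fourierTransform PrimePower.G γ) 0 ∧
    HasSum (fun γ : PrimePower.zetaOrdinates => ∑' j : ℕ+, PrimePower.termGHat γ j) 0 ∧
    HasSum (fun γ : PrimePower.zetaOrdinates =>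
      (PrimePower.zetaMultiplicity γ : ℂ) * PrimePower.fourierTransform PrimePower.G γ) 0 ∧
    HasSum (fun γ : PrimePower.zetaOrdinates =>
      (PrimePower.zetaMultiplicity γ : ℂ) * ∑' j : ℕ+, PrimePower.termGHat γ j) 0 := by
  have hz : ∀ γ : PrimePower.zetaOrdinates, PrimePower.fourierTransform PrimePower.G γ = 0 :=
    fun γ => PrimePower.fourierTransform_G_eq_zero γ.2
  have hs : ∀ γ : PrimePower.zetaOrdinates, ∑' j : ℕ+, PrimePower.termGHat γ j = 0 :=
    fun γ => (PrimePower.hasSum_termGHat γ).tsum_eq.trans (hz γ)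
  refine ⟨fun v => (PrimePower.hasSum_termG v).summable, PrimePower.integrable_exp_mul_G,
    PrimePower.hasSum_termGHat, fun γ hγ => PrimePower.fourierTransform_G_eq_zero hγ,
    ?_, ?_, ?_, ?_⟩ <;> simp only [hz, hs, mul_zero, hasSum_zero]
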